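/- Let $d\ge 1$ be an integer, let $\mathbb B_d$ be the open unit ball of $\mathbb C^d$ and $\partial\mathbb B_d$ its boundary sphere. For a holomorphic function $f$ on $\mathbb B_d$ put $$|||f|||=\sup_{\zeta\in\partial\mathbb B_d}\ \sup_{0<r<1}\int_0^{2\pi}\log\bigl(1+|f(re^{i\theta}\zeta)|\bigr)\,\frac{d\theta}{2\pi}\in[0,\infty],$$ let $\rho(f,g)=|||f-g|||$, let $N_u$ be the set of holomorphic $f$ on $\mathbb B_d$ with $|||f|||<\infty$, and let $$N_u^+=\{f\in N_u:\ \lim_{r\uparrow 1}\rho(f_r,f)=0\},\qquad f_r(z)=f(rz).$$ Then $N_u^+$ is a complex vector space and $\rho$ is a metric on it. For $\alpha\in\mathbb N^d$ (with $0\in\mathbb N$) let $|\alpha|=\alpha_1+\dots+\alpha_d$, let $\omega_\alpha=\sqrt{\alpha_1!\cdots\alpha_d!/|\alpha|!}$, and let $\widehat f(\alpha)$ be the coefficient of $z^\alpha$ in the Taylor series of $f$ at $0$. Let $(\gamma_\alpha)_{\alpha\in\mathbb N^d}$ be any family of complex numbers. Then the functional $$\Gamma: f\mapsto\sum_{\alpha\in\mathbb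 N^d}\widehat f(\alpha)\,\overline{\gamma_\alpha}$$ is a continuous linear functional on $(N_u^+,\rho)$ if and only if there exist constants $M,c>0$ such that $$|\gamma_\alpha|\le M\,\omega_\alpha\,e^{-c\sqrt{|\alpha|}}\qquad\text{for all }\alpha\in\mathbb N^d.$$ This equivalence holds both when the left-hand side means that the series converges (unconditionally) for every $f\in N_u^+$ and its sum is a $\rho$-continuous linear functional of $f$, and when it only means that there is a $\rho$-continuous linear functional $\Gamma$ on $N_u^+$ with $\Gamma(z^\alpha)=\overline{\gamma_\alpha}$ for all $\alpha$. When the condition holds, the series converges absolutely for every $f\in N_u^+$. -/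

import Mathlib

open scoped ENNReal Topology

namespace UniformSmirnov

/-- The space `ℂ^d` with its Euclidean norm. -/
abbrev Cd (d : ℕ) : Type := EuclideanSpace ℂ (Fin d)

/-- The open unit ball of `ℂ^d`. -/
abbrev unitBall (d : ℕ) : Set (Cd d) := Metric.ball 0 1

/-- `|||f||| = sup_{|ζ| = 1} sup_{0 < r < 1} ∫ log (1 + |f (r e^{iθ} ζ)|) dθ / 2π`, as an extended
nonnegative real. Only the values of `f` on the open unit ball enter. -/
noncomputable def logGauge {d : ℕ} (f : Cd d → ℂ) : ℝ≥0∞ :=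
  ⨆ ζ ∈ Metric.sphere (0 : Cd d) 1, ⨆ r ∈ Set.Ioo (0 : ℝ) 1,
    ENNReal.ofReal (Real.circleAverage (fun w : ℂ => Real.log (1 + ‖f (w • ζ)‖)) 0 r)

/-- Functions that are holomorphic on the open unit ball. A function on the ball is represented by
its extension by zero to `ℂ^d`, so that two representatives are equal if and only if they agree on
the ball. -/
def IsHolo {d : ℕ} (f : Cd d → ℂ) : Prop :=
  AnalyticOnNhd ℂ f (unitBall d) ∧ ∀ z, z ∉ unitBall d → f z = 0

/-- Membership in the uniform Nevanlinna class `N_u`. -/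
def MemNu {d : ℕ} (f : Cd d → ℂ) : Prop :=
  IsHolo f ∧ logGauge f < ∞

/-- Membership in the uniform Smirnov class `N_u^+`: `f` lies in `N_u`, and the dilations
`f_r (z) = f (r z)` tend to `f` with respect to `ρ (f, g) = |||f - g|||` as `r ↑ 1`. -/
def MemNuPlus {d : ℕ} (f : Cd d → ℂ) : Prop :=
  MemNu f ∧
    Filter.Tendsto (fun r : ℝ => logGauge fun z => f (r • z) - f z) (𝓝[<] 1) (𝓝 0)

section Basic

variable {d : ℕ}

theorem circle_mem {ζ : Cd d} (hζ : ζ ∈ Metric.sphere (0 : Cd d) 1) {r : ℝ}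
    (hr : r ∈ Set.Ioo (0 : ℝ) 1) {w : ℂ} (hw : w ∈ Metric.sphere (0 : ℂ) r) :
    w • ζ ∈ unitBall d := by
  simp only [mem_sphere_iff_norm, sub_zero] at hζ hw
  simp [norm_smul, hζ, hw, hr.2]

theorem continuousOn_logSlice {f : Cd d → ℂ} (hf : ContinuousOn f (unitBall d)) {ζ : Cd d}
    (hζ : ζ ∈ Metric.sphere (0 : Cd d) 1) {r : ℝ} (hr : r ∈ Set.Ioo (0 : ℝ) 1) :
    ContinuousOn (fun w : ℂ => Real.log (1 + ‖f (w • ζ)‖)) (Metric.sphere 0 r) := by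
  have h1 : ContinuousOn (fun w : ℂ => f (w • ζ)) (Metric.sphere 0 r) :=
    hf.comp (by fun_prop) fun w hw => circle_mem hζ hr hw
  refine ContinuousOn.log (continuousOn_const.add h1.norm) fun w _ => ?_
  positivity

theorem circleIntegrable_logSlice {f : Cd d → ℂ} (hf : ContinuousOn f (unitBall d)) {ζ : Cd d}
    (hζ : ζ ∈ Metric.sphere (0 : Cd d) 1) {r : ℝ} (hr : r ∈ Set.Ioo (0 : ℝ) 1) :
    CircleIntegrable (fun w : ℂ => Real.log (1 + ‖f (w • ζ)‖)) 0 r :=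
  (continuousOn_logSlice hf hζ hr).circleIntegrable hr.1.le

theorem log_nonneg' (x : ℂ) : 0 ≤ Real.log (1 + ‖x‖) :=
  Real.log_nonneg (by linarith [norm_nonneg x])

theorem circleAverage_le_logGauge (f : Cd d → ℂ) {ζ : Cd d}
    (hζ : ζ ∈ Metric.sphere (0 : Cd d) 1) {r : ℝ} (hr : r ∈ Set.Ioo (0 : ℝ) 1) :
    ENNReal.ofReal (Real.circleAverage (fun w : ℂ => Real.log (1 + ‖f (w • ζ)‖)) 0 r)
      ≤ logGauge f :=
  le_iSup₂_of_le ζ hζ (le_iSup₂_of_le r hr le_rfl)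

theorem logGauge_add_le {f g : Cd d → ℂ} (hf : ContinuousOn f (unitBall d))
    (hg : ContinuousOn g (unitBall d)) :
    logGauge (fun z => f z + g z) ≤ logGauge f + logGauge g := by
  refine iSup₂_le fun ζ hζ => iSup₂_le fun r hr => ?_
  refine le_trans ?_ (add_le_add (circleAverage_le_logGauge f hζ hr) (circleAverage_le_logGauge g hζ hr))
  have If := circleIntegrable_logSlice hf hζ hr
  have Ig := circleIntegrable_logSlice hg hζ hr
  rw [← ENNReal.ofReal_add (Real.circleAverage_nonneg_of_nonneg fun _ _ => log_nonneg' _)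
    (Real.circleAverage_nonneg_of_nonneg fun _ _ => log_nonneg' _),
    ← Real.circleAverage_fun_add If Ig]
  refine ENNReal.ofReal_le_ofReal (Real.circleAverage_mono
    (circleIntegrable_logSlice (hf.add hg) hζ hr) (If.add Ig) fun w _ => ?_)
  simp only
  rw [← Real.log_mul (by positivity) (by positivity)]
  refine Real.log_le_log (by positivity) ?_
  nlinarith [norm_add_le (f (w • ζ)) (g (w • ζ)),
    mul_nonneg (norm_nonneg (f (w • ζ))) (norm_nonneg (g (w • ζ)))]

theorem logGauge_smul_le {f : Cd d → ℂ} (hf : ContinuousOn f (unitBall d)) (c : ℂ) :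
    logGauge (fun z => c * f z) ≤ (⌈‖c‖⌉₊ : ℝ≥0∞) * logGauge f := by
  refine iSup₂_le fun ζ hζ => iSup₂_le fun r hr => ?_
  refine le_trans ?_ (mul_le_mul_right (circleAverage_le_logGauge f hζ hr) _)
  have If := circleIntegrable_logSlice hf hζ hr
  rw [← ENNReal.ofReal_natCast, ← ENNReal.ofReal_mul (Nat.cast_nonneg _), ← smul_eq_mul,
    ← Real.circleAverage_fun_smul]
  refine ENNReal.ofReal_le_ofReal (Real.circleAverage_mono
    (circleIntegrable_logSlice (continuousOn_const.mul hf) hζ hr) (If.const_smul) fun w _ => ?_)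
  simp only [smul_eq_mul]
  rw [← Real.log_pow]
  refine Real.log_le_log (by positivity) ?_
  have h1 := one_add_mul_le_pow (a := ‖f (w • ζ)‖) (by linarith [norm_nonneg (f (w • ζ))]) ⌈‖c‖⌉₊
  have h2 : ‖c‖ * ‖f (w • ζ)‖ ≤ ⌈‖c‖⌉₊ * ‖f (w • ζ)‖ :=
    mul_le_mul_of_nonneg_right (Nat.le_ceil _) (norm_nonneg _)
  rw [norm_mul]
  linarith

@[simp] theorem logGauge_zero : logGauge (fun _ : Cd d => (0 : ℂ)) = 0 := by
  simp [logGauge, Real.circleAverage_def]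

theorem logGauge_sub_comm (f g : Cd d → ℂ) :
    logGauge (fun z => f z - g z) = logGauge (fun z => g z - f z) := by
  simp only [logGauge, norm_sub_rev]

theorem continuousOn_dilation {f : Cd d → ℂ} (hf : ContinuousOn f (unitBall d)) {r : ℝ}
    (hr : r ∈ Set.Ioo (0 : ℝ) 1) :
    ContinuousOn (fun z => f (r • z) - f z) (unitBall d) := by
  refine ContinuousOn.sub (hf.comp (by fun_prop) fun z hz => ?_) hf
  simp only [mem_ball_zero_iff] at hz ⊢
  rw [norm_smul, Real.norm_of_nonneg hr.1.le]
  nlinarith [hr.1, hr.2, norm_nonneg z]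

theorem eventually_Ioo : ∀ᶠ r : ℝ in 𝓝[<] 1, r ∈ Set.Ioo (0 : ℝ) 1 :=
  Ioo_mem_nhdsLT one_pos

theorem IsHolo.continuousOn {f : Cd d → ℂ} (hf : IsHolo f) : ContinuousOn f (unitBall d) :=
  hf.1.continuousOn

theorem memNuPlus_zero : MemNuPlus (0 : Cd d → ℂ) := by
  refine ⟨⟨⟨analyticOnNhd_const, fun _ _ => rfl⟩, ?_⟩, ?_⟩
  · change logGauge (fun _ : Cd d => (0 : ℂ)) < ∞
    simp
  · simp

theorem MemNuPlus.add {f g : Cd d → ℂ} (hf : MemNuPlus f) (hg : MemNuPlus g) :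
    MemNuPlus (f + g) := by
  have cf := hf.1.1.continuousOn
  have cg := hg.1.1.continuousOn
  refine ⟨⟨⟨hf.1.1.1.add hg.1.1.1, fun z hz => ?_⟩, ?_⟩, ?_⟩
  · simp [hf.1.1.2 z hz, hg.1.1.2 z hz]
  · exact lt_of_le_of_lt (logGauge_add_le cf cg) (ENNReal.add_lt_top.2 ⟨hf.1.2, hg.1.2⟩)
  · have h := hf.2.add hg.2
    rw [add_zero] at h
    refine tendsto_of_tendsto_of_tendsto_of_le_of_le' tendsto_const_nhds h
      (Filter.Eventually.of_forall fun _ => zero_le) ?_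
    filter_upwards [eventually_Ioo] with r hr
    refine le_trans (le_of_eq ?_)
      (logGauge_add_le (continuousOn_dilation cf hr) (continuousOn_dilation cg hr))
    congr 1
    funext z
    simp only [Pi.add_apply]
    ring

theorem MemNuPlus.smul {f : Cd d → ℂ} (hf : MemNuPlus f) (c : ℂ) : MemNuPlus (c • f) := by
  have cf := hf.1.1.continuousOn
  refine ⟨⟨⟨(analyticOnNhd_const (v := c)).smul hf.1.1.1, fun z hz => ?_⟩, ?_⟩, ?_⟩
  · simp [hf.1.1.2 z hz]
  · exact lt_of_le_of_lt (logGauge_smul_le cf c)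
      (ENNReal.mul_lt_top (ENNReal.natCast_lt_top _) hf.1.2)
  · have h := ENNReal.Tendsto.const_mul (a := (⌈‖c‖⌉₊ : ℝ≥0∞)) hf.2
      (Or.inr (ENNReal.natCast_ne_top _))
    rw [mul_zero] at h
    refine tendsto_of_tendsto_of_tendsto_of_le_of_le' tendsto_const_nhds h
      (Filter.Eventually.of_forall fun _ => zero_le) ?_
    filter_upwards [eventually_Ioo] with r hr
    refine le_trans (le_of_eq ?_) (logGauge_smul_le (continuousOn_dilation cf hr) c)
    congr 1
    funext z
    simp only [Pi.smul_apply, smul_eq_mul]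
    ring

theorem eq_zero_of_logGauge_eq_zero [NeZero d] {f : Cd d → ℂ} (hf : IsHolo f) (h : logGauge f = 0) :
    f = 0 := by
  have cf := hf.continuousOn
  have key : ∀ ζ ∈ Metric.sphere (0 : Cd d) 1, ∀ r ∈ Set.Ioo (0 : ℝ) 1, f ((r : ℂ) • ζ) = 0 := by
    intro ζ hζ r hr
    by_contra hne
    have h1 := circleAverage_le_logGauge f hζ hr
    rw [h, nonpos_iff_eq_zero, ENNReal.ofReal_eq_zero, Real.circleAverage_def, smul_eq_mul] at h1
    have h2 : 0 < ∫ θ in (0 : ℝ)..2 * Real.pi,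
        Real.log (1 + ‖f (circleMap 0 r θ • ζ)‖) := by
      refine intervalIntegral.integral_pos (by positivity) ?_ (fun _ _ => log_nonneg' _)
        ⟨0, ⟨le_rfl, by positivity⟩, ?_⟩
      · exact (continuousOn_logSlice cf hζ hr).comp (continuous_circleMap 0 r).continuousOn
          fun θ _ => circleMap_mem_sphere 0 hr.1.le θ
      · refine Real.log_pos ?_
        have : 0 < ‖f ((r : ℂ) • ζ)‖ := norm_pos_iff.2 hne
        simpa [circleMap] using this
    have h3 : 0 < (2 * Real.pi)⁻¹ := by positivity
    nlinarith [mul_pos h3 h2]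
  have hz : ∀ z : Cd d, z ≠ 0 → f z = 0 := by
    intro z hz
    by_cases hb : z ∈ unitBall d
    · have hp : 0 < ‖z‖ := norm_pos_iff.2 hz
      have h1 := key ((‖z‖⁻¹ : ℂ) • z) (by
        simp [norm_smul, hp.ne']) ‖z‖ ⟨hp, by simpa using hb⟩
      rwa [smul_smul, mul_inv_cancel₀ (by exact_mod_cast hp.ne'), one_smul] at h1
    · exact hf.2 z hb
  funext z
  by_cases h0 : z = 0
  · subst h0
    have hc : ContinuousAt f 0 := cf.continuousAt (Metric.ball_mem_nhds 0 one_pos)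
    have hne : (𝓝[≠] (0 : Cd d)).NeBot := inferInstance
    have ht : Filter.Tendsto f (𝓝[≠] 0) (𝓝 0) :=
      tendsto_const_nhds.congr' (by
        filter_upwards [self_mem_nhdsWithin] with w hw using (hz w hw).symm)
    exact tendsto_nhds_unique (hc.tendsto.mono_left nhdsWithin_le_nhds) ht
  · exact hz z h0

end Basic

/-- The uniform Smirnov class as a linear subspace of the space of functions. -/
def nuPlus (d : ℕ) : Submodule ℂ (Cd d → ℂ) where
  carrier := {f | MemNuPlus f}
  add_mem' := fun hf hg => hf.add hg
  zero_mem' := memNuPlus_zero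
  smul_mem' := fun c _ hf => hf.smul c

/-- The uniform Smirnov class `N_u^+` on the unit ball of `ℂ^d`, as a complex vector space. It is
a type of its own so that it carries the topology of the metric `ρ` below, and not the topology of
pointwise convergence. -/
def NuPlus (d : ℕ) : Type := nuPlus d

namespace NuPlus

variable {d : ℕ}

noncomputable instance : AddCommGroup (NuPlus d) := inferInstanceAs (AddCommGroup (nuPlus d))

noncomputable instance : Module ℂ (NuPlus d) := inferInstanceAs (Module ℂ (nuPlus d))

/-- The function underlying an element of `N_u^+`. -/
def toFun (f : NuPlus d) : Cd d → ℂ := f.1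

instance : CoeFun (NuPlus d) fun _ => Cd d → ℂ := ⟨toFun⟩

theorem memNuPlus (f : NuPlus d) : MemNuPlus (f : Cd d → ℂ) := f.2

theorem sub_apply (f g : NuPlus d) (z : Cd d) : (f - g) z = f z - g z := rfl

theorem logGauge_sub_ne_top (f g : NuPlus d) : logGauge (fun z => f z - g z) ≠ ∞ :=
  (memNuPlus (f - g)).1.2.ne

/-- The metric `ρ (f, g) = |||f - g|||` on `N_u^+`. -/
noncomputable instance [NeZero d] : MetricSpace (NuPlus d) where
  dist f g := (logGauge fun z => f z - g z).toReal
  dist_self f := by simp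
  dist_comm f g := by rw [logGauge_sub_comm]
  dist_triangle f g h := by
    rw [← ENNReal.toReal_add (logGauge_sub_ne_top f g) (logGauge_sub_ne_top g h)]
    refine ENNReal.toReal_mono
      (ENNReal.add_ne_top.2 ⟨logGauge_sub_ne_top f g, logGauge_sub_ne_top g h⟩) ?_
    refine le_trans (le_of_eq ?_) (logGauge_add_le (memNuPlus (f - g)).1.1.continuousOn
      (memNuPlus (g - h)).1.1.continuousOn)
    congr 1
    funext z
    exact (sub_add_sub_cancel (f z) (g z) (h z)).symm
  eq_of_dist_eq_zero {f g} h := by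
    have h1 : logGauge (f - g : NuPlus d) = 0 :=
      ((ENNReal.toReal_eq_zero_iff _).1 h).resolve_right (logGauge_sub_ne_top f g)
    have h2 := eq_zero_of_logGauge_eq_zero (memNuPlus (f - g)).1.1 h1
    exact sub_eq_zero.1 (Subtype.ext h2)

theorem dist_def [NeZero d] (f g : NuPlus d) :
    dist f g = (logGauge fun z => f z - g z).toReal := rfl

end NuPlus

section MultiIndex

variable {d : ℕ}

/-- The length `|α| = α_1 + ⋯ + α_d` of a multi-index. -/
def length (α : Fin d → ℕ) : ℕ := ∑ i, α i

/-- The factorial `α! = α_1! ⋯ α_d!` of a multi-index. -/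
def factorial (α : Fin d → ℕ) : ℕ := ∏ i, (α i).factorial

/-- `ω_α = (α! / |α|!)^{1/2}`. -/
noncomputable def omega (α : Fin d → ℕ) : ℝ :=
  Real.sqrt ((factorial α : ℝ) / ((length α).factorial : ℝ))

/-- The list in which each coordinate index `i` occurs exactly `α i` times. -/
def directions (α : Fin d → ℕ) : List (Fin d) :=
  (List.finRange d).flatMap fun i => List.replicate (α i) i

/-- The partial derivative `∂^α f (0)`: the derivative of order `|α|` at the origin, applied to
`α i` copies of the `i`-th standard basis vector for each `i`. -/
noncomputable def partialAtZero (f : Cd d → ℂ) (α : Fin d → ℕ) : ℂ :=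
  iteratedFDeriv ℂ (directions α).length f 0
    fun k => EuclideanSpace.single ((directions α).get k) (1 : ℂ)

/-- The Taylor coefficient of `z^α` of `f` at the origin, `∂^α f (0) / α!`. -/
noncomputable def taylorCoeff (f : Cd d → ℂ) (α : Fin d → ℕ) : ℂ :=
  partialAtZero f α / (factorial α : ℂ)

open Classical in
/-- The monomial `z^α` as a function on the unit ball (extended by zero). -/
noncomputable def monomialFun (α : Fin d → ℕ) : Cd d → ℂ :=
  fun z => if z ∈ unitBall d then ∏ i, z i ^ α i else 0

theorem logGauge_le_of_norm_le {f : Cd d → ℂ} (hf : ContinuousOn f (unitBall d)) {C : ℝ}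
    (hC : ∀ z ∈ unitBall d, ‖f z‖ ≤ C) : logGauge f ≤ ENNReal.ofReal C := by
  refine iSup₂_le fun ζ hζ => iSup₂_le fun r hr => ENNReal.ofReal_le_ofReal ?_
  refine Real.circleAverage_mono_on_of_le_circle (circleIntegrable_logSlice hf hζ hr)
    fun w hw => ?_
  rw [abs_of_pos hr.1] at hw
  have h1 := Real.log_le_sub_one_of_pos (x := 1 + ‖f (w • ζ)‖) (by positivity)
  have h2 := hC _ (circle_mem hζ hr hw)
  linarith

theorem norm_prod_le_one (α : Fin d → ℕ) {z : Cd d} (hz : z ∈ unitBall d) :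
    ‖∏ i, z i ^ α i‖ ≤ 1 := by
  rw [norm_prod]
  refine Finset.prod_le_one (fun _ _ => norm_nonneg _) fun i _ => ?_
  rw [norm_pow]
  exact pow_le_one₀ (norm_nonneg _)
    ((PiLp.norm_apply_le z i).trans (by simpa using (mem_ball_zero_iff.1 hz).le))

theorem isHolo_monomialFun (α : Fin d → ℕ) : IsHolo (monomialFun α) := by
  refine ⟨?_, fun z hz => by simp [monomialFun, hz]⟩
  have h : AnalyticOnNhd ℂ (fun z : Cd d => ∏ i, z i ^ α i) (unitBall d) :=
    Finset.analyticOnNhd_fun_prod _ fun i _ =>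
      ((EuclideanSpace.proj (𝕜 := ℂ) i).analyticOnNhd _).pow (α i)
  exact h.congr Metric.isOpen_ball fun z hz => by simp only [monomialFun, if_pos hz]

theorem memNuPlus_monomialFun (α : Fin d → ℕ) : MemNuPlus (monomialFun α) := by
  have hh := isHolo_monomialFun α
  refine ⟨⟨hh, ?_⟩, ?_⟩
  · refine lt_of_le_of_lt (logGauge_le_of_norm_le hh.continuousOn (C := 1) fun z hz => ?_)
      ENNReal.ofReal_lt_top
    rw [monomialFun, if_pos hz]
    exact norm_prod_le_one α hz
  · have h : Filter.Tendsto (fun r : ℝ => ENNReal.ofReal (1 - r ^ length α)) (𝓝[<] 1) (𝓝 0) := by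
      have h1 : Continuous fun r : ℝ => ENNReal.ofReal (1 - r ^ length α) :=
        ENNReal.continuous_ofReal.comp (by fun_prop)
      simpa using (h1.tendsto 1).mono_left nhdsWithin_le_nhds
    refine tendsto_of_tendsto_of_tendsto_of_le_of_le' tendsto_const_nhds h
      (Filter.Eventually.of_forall fun _ => zero_le) ?_
    filter_upwards [eventually_Ioo] with r hr
    refine logGauge_le_of_norm_le (continuousOn_dilation hh.continuousOn hr) fun z hz => ?_
    have hrz : r • z ∈ unitBall d := by
      simp only [mem_ball_zero_iff] at hz ⊢
      rw [norm_smul, Real.norm_of_nonneg hr.1.le]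
      nlinarith [hr.1, hr.2, norm_nonneg z]
    have h2 : r ^ length α ≤ 1 := pow_le_one₀ hr.1.le hr.2.le
    have h3 : ∏ i, (r • z) i ^ α i - ∏ i, z i ^ α i
        = ((r ^ length α - 1 : ℝ) : ℂ) * ∏ i, z i ^ α i := by
      simp only [PiLp.smul_apply, Complex.real_smul, mul_pow, Finset.prod_mul_distrib,
        Finset.prod_pow_eq_pow_sum, length]
      push_cast
      ring
    simp only [monomialFun, if_pos hz, if_pos hrz]
    rw [h3, norm_mul, Complex.norm_real, Real.norm_eq_abs, abs_sub_comm,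
      abs_of_nonneg (sub_nonneg.2 h2)]
    exact mul_le_of_le_one_right (sub_nonneg.2 h2) (norm_prod_le_one α hz)

/-- The condition `|γ_α| ≤ M ω_α e^{-c √|α|}` for all multi-indices `α`, with some constants
`M, c > 0`. -/
def DecayCondition (γ : (Fin d → ℕ) → ℂ) : Prop :=
  ∃ M > (0 : ℝ), ∃ c > (0 : ℝ), ∀ α : Fin d → ℕ,
    ‖γ α‖ ≤ M * omega α * Real.exp (-c * Real.sqrt (length α : ℝ))

/-- The monomial `z^α` as an element of `N_u^+`. -/
noncomputable def NuPlus.monomial (α : Fin d → ℕ) : NuPlus d :=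
  ⟨monomialFun α, memNuPlus_monomialFun α⟩

end MultiIndex

end UniformSmirnov

/-! The weight `ω_α` is, up to a polynomial factor in `|α|`, the maximum of `|z^α|` over the unit
sphere. Cauchy estimates on tori in the sphere therefore reduce both directions to functions of one
variable, and the polynomial factors are absorbed by lowering `c`.

Sufficiency: `log (1 + |u|)` is subharmonic, so a bound `ε` on its circular means gives `log (1 +
|u(w)|) ≲ ε / (1 - |w|)` (`log_one_add_norm_le`). The Cauchy estimate at radius `1 - δ/√(n+1)`
bounds the `n`-th Taylor coefficient of each slice by `ε` times `√(n+1) e^{3δ√(n+1)}`, up to a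
factor depending on `δ`, whenever `ε ≤ δ²/4`. For `f` in `N_u^+` this applies to `f_r - f` with `r`
near `1`, for arbitrarily small `δ`; its homogeneous parts are those of `f` times `r^n - 1`. So the
coefficients of `f` grow more slowly than `ω_α⁻¹ e^{c√|α|}` for every `c > 0`, and the series
converges absolutely. Linearity of the estimate in `ε` yields continuity.

Necessity: a continuous functional is bounded by `1` on a `ρ`-ball around `0`. For every `n` that
ball contains functions `P(∑ z_i η_i)` with `∑ |η_i|² = 1` whose polynomial `P` has `n`-th
coefficient at least of order `e^{c√n} / (n+1)` (`exists_polynomial_large_coeff`). Here `P = κ (1 +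
(κ/k) F)^k`, where `F` completes a Fejér kernel analytically and `k` is about `√(κn)/2`. Since `Re F
≥ 0`, the base has no zeros and the mean of its `log | |` is the value at `0`, which keeps the gauge
at most `2κ`. The value of the functional is a polynomial in `η`, and a Cauchy estimate in `η`
isolates `γ_α`. -/

namespace UniformSmirnov
-- Cauchy estimates for polynomials on tori
section Coefficients

variable {d : ℕ}

/-- Orthogonality of the characters of the cyclic group of order `N`. -/
theorem sum_rootsOfUnity_zpow {N : ℕ} {ω : ℂ} (hω : IsPrimitiveRoot ω N) {a b : ℕ} (ha : a < N)
    (hb : b < N) :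
    ∑ k : Fin N, (ω ^ (k : ℕ)) ^ b * ((ω ^ (k : ℕ)) ^ a)⁻¹ = if b = a then (N : ℂ) else 0 := by
  have hN : 0 < N := by omega
  have hω0 : ω ≠ 0 := hω.ne_zero hN.ne'
  have h1 : ∀ k : Fin N, (ω ^ (k : ℕ)) ^ b * ((ω ^ (k : ℕ)) ^ a)⁻¹ = (ω ^ b * (ω ^ a)⁻¹) ^ (k : ℕ) := by
    intro k
    rw [mul_pow, inv_pow, ← pow_mul, ← pow_mul, ← pow_mul, ← pow_mul, mul_comm b, mul_comm a]
  rw [Finset.sum_congr rfl fun k _ => h1 k]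
  split_ifs with h
  · subst h
    simp [hω0]
  · have hne : ω ^ b * (ω ^ a)⁻¹ ≠ 1 := by
      intro h2
      exact h (hω.pow_inj hb ha (by
        rwa [← div_eq_mul_inv, div_eq_one_iff_eq (pow_ne_zero _ hω0)] at h2))
    rw [Fin.sum_univ_eq_sum_range fun k => (ω ^ b * (ω ^ a)⁻¹) ^ k, geom_sum_eq hne]
    have : (ω ^ b * (ω ^ a)⁻¹) ^ N = 1 := by
      rw [mul_pow, inv_pow, ← pow_mul, ← pow_mul, mul_comm b, mul_comm a, pow_mul, pow_mul,
        hω.pow_eq_one]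
      simp
    rw [this]
    simp

/-- **Cauchy estimate** on a torus for the coefficients of a polynomial. -/
theorem norm_coeff_mul_le (S : Finset (Fin d → ℕ)) (c : (Fin d → ℕ) → ℂ) {r : Fin d → ℝ}
    (hr : ∀ i, 0 ≤ r i) {C : ℝ}
    (hC : ∀ z : Fin d → ℂ, (∀ i, ‖z i‖ = r i) → ‖∑ β ∈ S, c β * ∏ i, z i ^ β i‖ ≤ C)
    {α : Fin d → ℕ} (hα : α ∈ S) : ‖c α‖ * ∏ i, r i ^ α i ≤ C := by
  classical
  obtain ⟨N, hN⟩ : ∃ N : ℕ, ∀ β ∈ S, ∀ i, β i < N := by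
    refine ⟨S.sup (fun β => Finset.univ.sup β) + 1, fun β hβ i => Nat.lt_succ_of_le ?_⟩
    exact (Finset.le_sup (f := β) (Finset.mem_univ i)).trans
      (Finset.le_sup (f := fun β : Fin d → ℕ => Finset.univ.sup β) hβ)
  -- Since `α i < N` for every `i`, this case forces `d = 0`.
  by_cases hd : N = 0
  · have : IsEmpty (Fin d) := ⟨fun i => by have := hN α hα i; omega⟩
    have hS : S = {α} := by
      ext β
      simp [Subsingleton.elim β α, hα]
    have := hC (fun i => isEmptyElim i) (fun i => isEmptyElim i)
    simpa [hS] using this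
  set ω : ℂ := Complex.exp (2 * Real.pi * Complex.I / N)
  have hω : IsPrimitiveRoot ω N := Complex.isPrimitiveRoot_exp N hd
  have hω1 : ‖ω‖ = 1 := hω.norm'_eq_one hd
  let χ : (Fin d → Fin N) → ℂ := fun k => ∏ i, ((ω ^ (k i : ℕ)) ^ α i)⁻¹
  have hχ : ∀ k, ‖χ k‖ = 1 := fun k => by simp [χ, norm_prod, hω1]
  let z : (Fin d → Fin N) → Fin d → ℂ := fun k i => r i * ω ^ (k i : ℕ)
  -- Averaging against the character `χ` over the `N`-th roots of unity isolates the coefficient of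
  -- `z^α`: all exponents are below `N`, so distinct ones give distinct characters.
  have key : ∑ k : Fin d → Fin N, χ k * ∑ β ∈ S, c β * ∏ i, z k i ^ β i
      = (N : ℂ) ^ d * (c α * ∏ i, (r i : ℂ) ^ α i) := by
    simp_rw [Finset.mul_sum]
    rw [Finset.sum_comm]
    have h2 : ∀ β ∈ S, ∑ k : Fin d → Fin N, χ k * (c β * ∏ i, z k i ^ β i)
        = if β = α then (N : ℂ) ^ d * (c α * ∏ i, (r i : ℂ) ^ α i) else 0 := by
      intro β hβ
      have h3 : ∀ k : Fin d → Fin N, χ k * (c β * ∏ i, z k i ^ β i)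
          = (c β * ∏ i, (r i : ℂ) ^ β i) *
            ∏ i, ((ω ^ (k i : ℕ)) ^ β i * ((ω ^ (k i : ℕ)) ^ α i)⁻¹) := by
        intro k
        simp only [χ, z, mul_pow, Finset.prod_mul_distrib]
        ring
      rw [Finset.sum_congr rfl fun k _ => h3 k, ← Finset.mul_sum,
        ← Fintype.piFinset_univ, ← Finset.prod_univ_sum (fun _ => Finset.univ)
          (fun i (k : Fin N) => (ω ^ (k : ℕ)) ^ β i * ((ω ^ (k : ℕ)) ^ α i)⁻¹),
        Finset.prod_congr rfl fun i _ => sum_rootsOfUnity_zpow hω (hN α hα i) (hN β hβ i)]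
      split_ifs with h
      · subst h
        simp [mul_comm]
      · obtain ⟨i, hi⟩ := Function.ne_iff.1 h
        rw [(Finset.prod_eq_zero (Finset.mem_univ i) (if_neg hi) :
          ∏ i, (if β i = α i then (N : ℂ) else 0) = 0), mul_zero]
    rw [Finset.sum_congr rfl h2]
    simp [hα]
  have hle : ‖∑ k : Fin d → Fin N, χ k * ∑ β ∈ S, c β * ∏ i, z k i ^ β i‖ ≤ (N : ℝ) ^ d * C := by
    refine (norm_sum_le _ _).trans ?_
    refine (Finset.sum_le_sum fun k _ => (?_ : _ ≤ C)).trans ?_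
    · rw [norm_mul, hχ, one_mul]
      exact hC _ fun i => by simp [z, hω1, abs_of_nonneg (hr i)]
    · simp
  rw [key, norm_mul, norm_mul, norm_prod] at hle
  have hNp : (0 : ℝ) < (N : ℝ) ^ d := by positivity
  have h4 : ∏ i, ‖(r i : ℂ) ^ α i‖ = ∏ i, r i ^ α i :=
    Finset.prod_congr rfl fun i _ => by simp [abs_of_nonneg (hr i)]
  rw [h4] at hle
  simp only [norm_pow, RCLike.norm_natCast] at hle
  exact le_of_mul_le_mul_left hle hNp

/-! ### Multilinear expansion and homogeneous parts -/

/-- The number of times each index is taken by a map. -/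
def content {n : ℕ} (κ : Fin n → Fin d) (i : Fin d) : ℕ :=
  Fintype.card {j // κ j = i}

theorem sum_content {n : ℕ} (κ : Fin n → Fin d) : ∑ i, content κ i = n := by
  simp only [content]
  rw [← Fintype.card_sigma, Fintype.card_congr (Equiv.sigmaFiberEquiv κ), Fintype.card_fin]

theorem prod_comp_eq_prod_pow_content {n : ℕ} (κ : Fin n → Fin d) (x : Fin d → ℂ) :
    ∏ j, x (κ j) = ∏ i, x i ^ content κ i := by
  rw [← Finset.prod_fiberwise (s := Finset.univ) κ]
  refine Finset.prod_congr rfl fun i _ => ?_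
  rw [Finset.prod_congr rfl (g := fun _ => x i), Finset.prod_const, content, Fintype.card_subtype]
  intro j hj
  rw [(Finset.mem_filter.1 hj).2]

theorem exists_perm_of_content_eq {n : ℕ} {κ κ' : Fin n → Fin d} (h : content κ = content κ') :
    ∃ σ : Equiv.Perm (Fin n), κ' ∘ σ = κ := by
  refine ⟨Equiv.ofFiberEquiv (f := κ) (g := κ')
    fun i => Fintype.equivOfCardEq (congrFun h i), ?_⟩
  funext j
  exact Equiv.ofFiberEquiv_map _ j

theorem count_directions (α : Fin d → ℕ) (i : Fin d) : (directions α).count i = α i := by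
  rw [directions, List.count_flatMap]
  simp only [Function.comp_def, List.count_replicate, beq_iff_eq]
  rw [← List.ofFn_eq_map, List.sum_ofFn]
  simp

theorem length_directions (α : Fin d → ℕ) : (directions α).length = length α := by
  simp [directions, List.length_flatMap, length, ← List.ofFn_eq_map, List.sum_ofFn]

theorem content_directions (α : Fin d → ℕ) : content (directions α).get = α := by
  funext i
  rw [← count_directions α i, content, Fintype.card_subtype]
  exact Fin.card_filter_univ_eq_vector_get_eq_count i ⟨directions α, rfl⟩

/-- Expanding `(∑ z_i)^n` over words and by the multinomial theorem gives the same polynomial. The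
Cauchy estimate with bound `0` then identifies the coefficients. -/
theorem card_content_eq {n : ℕ} {α : Fin d → ℕ} (hα : α ∈ Finset.univ.piAntidiag n) :
    (Finset.univ.filter fun κ : Fin n → Fin d => content κ = α).card
      = Nat.multinomial Finset.univ α := by
  classical
  have h1 : ∀ z : Fin d → ℂ, (∀ i, ‖z i‖ = (1 : ℝ)) →
      ‖∑ β ∈ Finset.univ.piAntidiag n,
        (((Finset.univ.filter fun κ : Fin n → Fin d => content κ = β).card : ℂ)
          - Nat.multinomial Finset.univ β) * ∏ i, z i ^ β i‖ ≤ 0 := by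
    intro z _
    simp_rw [sub_mul]
    rw [Finset.sum_sub_distrib, ← Finset.sum_pow_eq_sum_piAntidiag, Finset.sum_pow',
      Fintype.piFinset_univ]
    simp_rw [prod_comp_eq_prod_pow_content]
    rw [← Finset.sum_fiberwise_of_maps_to (t := Finset.univ.piAntidiag n) (g := content)
      (fun κ _ => by simp [Finset.mem_piAntidiag, sum_content]), ← Finset.sum_sub_distrib,
      Finset.sum_eq_zero, norm_zero]
    intro β _
    rw [sub_eq_zero, Finset.sum_congr rfl (g := fun _ => ∏ i, z i ^ β i), Finset.sum_const,
      nsmul_eq_mul]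
    intro κ hκ
    rw [(Finset.mem_filter.1 hκ).2]
  have h2 := norm_coeff_mul_le (r := fun _ => 1) _ _ (fun _ => zero_le_one) h1 hα
  simp only [one_pow, Finset.prod_const_one, mul_one, norm_le_zero_iff, sub_eq_zero] at h2
  exact_mod_cast h2

theorem multinomial_mul_factorial (α : Fin d → ℕ) :
    (factorial α) * Nat.multinomial Finset.univ α = (length α).factorial :=
  Nat.multinomial_spec _ _

/-- Expansion on the diagonal of a multilinear form whose values at tuples of basis vectors depend
only on how often each basis vector occurs. -/
theorem diagonal_eq_sum {n : ℕ} (M : ContinuousMultilinearMap ℂ (fun _ : Fin n => Cd d) ℂ)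
    (m : (Fin d → ℕ) → ℂ)
    (hm : ∀ κ : Fin n → Fin d, M (fun j => EuclideanSpace.single (κ j) 1) = m (content κ))
    (z : Cd d) :
    M (fun _ => z) = ∑ α ∈ Finset.univ.piAntidiag n,
      (Nat.multinomial Finset.univ α : ℂ) * m α * ∏ i, z i ^ α i := by
  classical
  have hz : z = ∑ i, z i • EuclideanSpace.single i (1 : ℂ) := by
    ext j
    simp [Finset.sum_apply, Pi.single_apply]
  have h1 : M (fun _ => z) = ∑ κ : Fin n → Fin d, m (content κ) * ∏ i, z i ^ content κ i := by
    conv_lhs => rw [hz]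
    rw [M.map_sum (fun _ i => z i • EuclideanSpace.single i (1 : ℂ))]
    refine Finset.sum_congr rfl fun κ _ => ?_
    rw [M.map_smul_univ (fun j => z (κ j)), hm, prod_comp_eq_prod_pow_content, smul_eq_mul, mul_comm]
  rw [h1, ← Finset.sum_fiberwise_of_maps_to (t := Finset.univ.piAntidiag n) (g := content)
      (fun κ _ => by simp [Finset.mem_piAntidiag, sum_content])]
  refine Finset.sum_congr rfl fun α hα => ?_
  rw [Finset.sum_congr rfl (g := fun _ => m α * ∏ i, z i ^ α i), Finset.sum_const,
      nsmul_eq_mul, card_content_eq hα, mul_assoc]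
  intro κ hκ
  rw [(Finset.mem_filter.1 hκ).2]

/-- Iterated derivatives of an analytic function are symmetric, and two words with the same content
differ by a permutation. -/
theorem partialAtZero_eq {f : Cd d → ℂ} (hf : AnalyticAt ℂ f 0) {n : ℕ} (κ : Fin n → Fin d) :
    iteratedFDeriv ℂ n f 0 (fun j => EuclideanSpace.single (κ j) 1)
      = partialAtZero f (content κ) := by
  have hn : n = (directions (content κ)).length := by
    rw [length_directions, length, sum_content]
  rw [partialAtZero]
  -- A general list makes its length a variable-free target for `subst`; `directions (content κ)`
  -- depends on `n` through `κ`.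
  have h : ∀ (l : List (Fin d)) (hn : n = l.length), content l.get = content κ →
      iteratedFDeriv ℂ n f 0 (fun j => EuclideanSpace.single (κ j) 1) =
      iteratedFDeriv ℂ l.length f 0 fun k => EuclideanSpace.single (l.get k) (1 : ℂ) := by
    intro l hn hl
    subst hn
    obtain ⟨σ, hσ⟩ := exists_perm_of_content_eq hl
    rw [← hf.contDiffAt.iteratedFDeriv_comp_perm (fun j => EuclideanSpace.single (κ j) (1 : ℂ)) σ]
    congr 1
    funext j
    exact congrArg (fun i => EuclideanSpace.single i (1 : ℂ)) (congrFun hσ j)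
  exact h _ hn (content_directions _)

/-- The homogeneous part of degree `n` of the Taylor series at the origin. -/
noncomputable def homogPart (f : Cd d → ℂ) (n : ℕ) (z : Cd d) : ℂ :=
  ∑ α ∈ Finset.univ.piAntidiag n, taylorCoeff f α * ∏ i, z i ^ α i

theorem factorial_mul_homogPart {f : Cd d → ℂ} (hf : AnalyticAt ℂ f 0) (n : ℕ) (z : Cd d) :
    (n.factorial : ℂ) * homogPart f n z = iteratedFDeriv ℂ n f 0 fun _ => z := by
  rw [diagonal_eq_sum _ (partialAtZero f)
    (fun κ => partialAtZero_eq hf κ), homogPart, Finset.mul_sum]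
  refine Finset.sum_congr rfl fun α hα => ?_
  have hn : length α = n := (Finset.mem_piAntidiag.1 hα).1
  have h1 : (factorial α : ℂ) ≠ 0 := by
    simp [factorial, Finset.prod_eq_zero_iff, Nat.factorial_ne_zero]
  rw [taylorCoeff, ← hn, ← multinomial_mul_factorial]
  push_cast
  field_simp

theorem norm_taylorCoeff_mul_le (f : Cd d → ℂ) {α : Fin d → ℕ} {r : Fin d → ℝ}
    (hr : ∀ i, 0 ≤ r i) {C : ℝ}
    (hC : ∀ z : Cd d, (∀ i, ‖z i‖ = r i) → ‖homogPart f (length α) z‖ ≤ C) :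
    ‖taylorCoeff f α‖ * ∏ i, r i ^ α i ≤ C :=
  norm_coeff_mul_le (Finset.univ.piAntidiag (length α)) (taylorCoeff f) hr
    (fun z hz => hC (WithLp.toLp 2 z) hz) (by simp [Finset.mem_piAntidiag, length])

/-! ### Stirling bounds and the weight `ω_α` -/

/-- A crude Stirling bound. The induction step amounts to `e ≤ (1 + 1/(a+1))^(a+2)`, which follows
from `log x ≥ 1 - 1/x`. -/
theorem factorial_le_exp_mul (a : ℕ) :
    (a.factorial : ℝ) ≤ Real.exp 1 * (a + 1) * ((a : ℝ) ^ a * Real.exp (-a)) := by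
  have h : ∀ a : ℕ, ((a + 1).factorial : ℝ)
      ≤ Real.exp 1 * (a + 1) * (((a : ℝ) + 1) ^ (a + 1) * Real.exp (-(a + 1))) := by
    intro a
    induction a with
    | zero => simp [← Real.exp_add]
    | succ a ih =>
      rw [Nat.factorial_succ]
      push_cast
      have h1 : Real.exp 1 * ((a : ℝ) + 1) ^ (a + 2) ≤ ((a : ℝ) + 2) ^ (a + 2) := by
        have h2 : 1 / ((a : ℝ) + 2) ≤ Real.log ((a + 2) / (a + 1)) := by
          have := Real.one_sub_inv_le_log_of_pos (x := ((a : ℝ) + 2) / (a + 1)) (by positivity)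
          refine le_trans (le_of_eq ?_) this
          field_simp
          ring
        have h3 : Real.exp 1 ≤ (((a : ℝ) + 2) / (a + 1)) ^ (a + 2) := by
          rw [← Real.exp_log (x := ((a : ℝ) + 2) / (a + 1)) (by positivity), ← Real.exp_nat_mul]
          refine Real.exp_le_exp.2 ?_
          push_cast
          calc (1 : ℝ) = (a + 2) * (1 / (a + 2)) := by field_simp
            _ ≤ _ := by gcongr
        calc _ ≤ (((a : ℝ) + 2) / (a + 1)) ^ (a + 2) * ((a : ℝ) + 1) ^ (a + 2) := by gcongr
          _ = _ := by rw [← mul_pow]; field_simp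
      calc ((a : ℝ) + 1 + 1) * ((a + 1).factorial : ℝ)
          ≤ (a + 1 + 1) * (Real.exp 1 * (a + 1) * (((a : ℝ) + 1) ^ (a + 1) * Real.exp (-(a + 1)))) := by
            gcongr
        _ = (a + 1 + 1) * (Real.exp 1 * ((a : ℝ) + 1) ^ (a + 2)) * Real.exp (-(a + 1)) := by ring
        _ ≤ (a + 1 + 1) * ((a : ℝ) + 2) ^ (a + 2) * Real.exp (-(a + 1)) := by gcongr
        _ = Real.exp 1 * (a + 1 + 1) * (((a : ℝ) + 1 + 1) ^ (a + 1 + 1) * Real.exp (-(a + 1 + 1))) := by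
            have : Real.exp (-((a : ℝ) + 1)) = Real.exp 1 * Real.exp (-(a + 1 + 1)) := by
              rw [← Real.exp_add]; congr 1; ring
            rw [this, show (a : ℝ) + 2 = a + 1 + 1 by ring]
            ring
  cases a with
  | zero => simp
  | succ a =>
    have := h a
    push_cast
    refine this.trans ?_
    gcongr
    linarith

theorem pow_mul_exp_neg_le_factorial (n : ℕ) : (n : ℝ) ^ n * Real.exp (-n) ≤ n.factorial := by
  have h := Real.pow_div_factorial_le_exp (n : ℝ) (by positivity) n
  rw [div_le_iff₀ (by positivity)] at h
  rw [Real.exp_neg, ← div_eq_mul_inv, div_le_iff₀ (Real.exp_pos _), mul_comm]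
  exact h

theorem omega_pos (α : Fin d → ℕ) : 0 < omega α := by
  refine Real.sqrt_pos.2 (div_pos ?_ (by positivity))
  have : 0 < factorial α := Finset.prod_pos fun i _ => Nat.factorial_pos _
  exact_mod_cast this

theorem omega_sq_mul_multinomial (α : Fin d → ℕ) :
    omega α ^ 2 * Nat.multinomial Finset.univ α = 1 := by
  have h : (factorial α : ℝ) * Nat.multinomial Finset.univ α = (length α).factorial := by
    exact_mod_cast multinomial_mul_factorial α
  rw [omega, Real.sq_sqrt (by positivity), div_mul_eq_mul_div, h, div_self]
  positivity

/-- The weight `ω_α` is, up to a power of `|α| + 1`, at most the value of the monomial `z^α` at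
a suitable point of the unit sphere. -/
theorem exists_omega_le [NeZero d] (α : Fin d → ℕ) :
    ∃ r : Fin d → ℝ, (∀ i, 0 ≤ r i) ∧ ∑ i, r i ^ 2 = 1 ∧
      omega α ≤ (Real.exp 1 * (length α + 1)) ^ d * ∏ i, r i ^ α i := by
  set n := length α with hn
  have hbase : (1 : ℝ) ≤ Real.exp 1 * (n + 1) := by
    have := Real.add_one_le_exp (1 : ℝ)
    nlinarith [Nat.cast_nonneg (α := ℝ) n]
  have hB : (1 : ℝ) ≤ (Real.exp 1 * (n + 1)) ^ d := one_le_pow₀ hbase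
  have hi : ∀ i, α i ≤ n := fun i => Finset.single_le_sum (fun _ _ => Nat.zero_le _) (Finset.mem_univ i)
  -- For `n = 0` the general choice `√(α_i / n)` would be the zero vector, which is off the sphere;
  -- any unit vector serves.
  rcases Nat.eq_zero_or_pos n with h0 | hpos
  · have hα : α = 0 := by
      funext i
      have := hi i
      simp only [Pi.zero_apply]
      omega
    refine ⟨Pi.single 0 1, fun i => ?_, ?_, ?_⟩
    · by_cases h : i = 0
      · subst h; simp
      · simp [h]
    · rw [Finset.sum_eq_single 0] <;> simp +contextual
    · subst hα
      have : omega (0 : Fin d → ℕ) = 1 := by simp [omega, factorial, length]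
      rw [this]
      simpa using hB
  · have hnp : (0 : ℝ) < n := by exact_mod_cast hpos
    -- This is the point of the sphere where `|z^α|` is largest; the square of that value is `∏
    -- α_i^{α_i} / n^n`.
    refine ⟨fun i => Real.sqrt (α i / n), fun i => Real.sqrt_nonneg _, ?_, ?_⟩
    · simp_rw [Real.sq_sqrt (div_nonneg (Nat.cast_nonneg (α := ℝ) _) hnp.le)]
      rw [← Finset.sum_div, div_eq_one_iff_eq hnp.ne', hn, length]
      push_cast
      rfl
    · have hP : 0 ≤ ∏ i, Real.sqrt (α i / n) ^ α i := Finset.prod_nonneg fun i _ => by positivity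
      have hsq : (∏ i, Real.sqrt (α i / n) ^ α i) ^ 2 = (∏ i, (α i : ℝ) ^ α i) / (n : ℝ) ^ n := by
        have : (n : ℝ) ^ n = ∏ i, (n : ℝ) ^ α i := by
          rw [Finset.prod_pow_eq_pow_sum, hn, length]
        rw [← Finset.prod_pow, this, ← Finset.prod_div_distrib]
        refine Finset.prod_congr rfl fun i _ => ?_
        rw [← pow_mul, mul_comm, pow_mul, Real.sq_sqrt (by positivity), div_pow]
      have hfac : (factorial α : ℝ)
          ≤ (Real.exp 1 * (n + 1)) ^ d * ((∏ i, (α i : ℝ) ^ α i) * Real.exp (-n)) := by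
        have h1 : ((factorial α : ℕ) : ℝ)
            ≤ ∏ i, (Real.exp 1 * (n + 1) * ((α i : ℝ) ^ α i * Real.exp (-(α i : ℝ)))) := by
          rw [factorial]
          push_cast
          refine Finset.prod_le_prod (fun _ _ => by positivity) fun i _ =>
            (factorial_le_exp_mul (α i)).trans ?_
          have : (α i : ℝ) ≤ n := by exact_mod_cast hi i
          gcongr
        refine h1.trans (le_of_eq ?_)
        have h2 : ∏ i, Real.exp (-(α i : ℝ)) = Real.exp (-n) := by
          rw [← Real.exp_sum, Finset.sum_neg_distrib, hn, length]
          push_cast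
          rfl
        rw [Finset.prod_mul_distrib, Finset.prod_const, Finset.prod_mul_distrib, h2]
        simp
      -- After squaring, the upper Stirling bound for each `α_i!` meets the lower one for `n!`; the
      -- exponentials cancel because `∑ α_i = n`.
      refine Real.sqrt_le_iff.2 ⟨by positivity, ?_⟩
      rw [div_le_iff₀ (by positivity), mul_pow, hsq]
      have hs := pow_mul_exp_neg_le_factorial n
      have hB2 : (Real.exp 1 * ((n : ℝ) + 1)) ^ d ≤ ((Real.exp 1 * (n + 1)) ^ d) ^ 2 := by
        nlinarith
      have hQ : 0 ≤ ∏ i, (α i : ℝ) ^ α i := Finset.prod_nonneg fun i _ => by positivity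
      calc (factorial α : ℝ) ≤ _ := hfac
        _ ≤ ((Real.exp 1 * (n + 1)) ^ d) ^ 2 * ((∏ i, (α i : ℝ) ^ α i) * Real.exp (-n)) := by
            gcongr
        _ = ((Real.exp 1 * (n + 1)) ^ d) ^ 2 * ((∏ i, (α i : ℝ) ^ α i) / (n : ℝ) ^ n) *
            ((n : ℝ) ^ n * Real.exp (-n)) := by
            have : (n : ℝ) ^ n ≠ 0 := by positivity
            field_simp
        _ ≤ _ := by gcongr

end Coefficients
-- Subharmonicity of `log (1 + |u|)` and Taylor coefficients on the disc
section Disc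

instance fact_two_pi_pos : Fact (0 < 2 * Real.pi) := ⟨Real.two_pi_pos⟩

/-- A real continuous function on a circle is uniformly approximated by real parts of entire
functions. -/
theorem exists_differentiable_re_near {v : ℂ → ℝ} {R : ℝ} (hR : 0 < R)
    (hv : ContinuousOn v (Metric.sphere 0 R)) {η : ℝ} (hη : 0 < η) :
    ∃ q : ℂ → ℂ, Differentiable ℂ q ∧ ∀ w ∈ Metric.sphere (0 : ℂ) R, |(q w).re - v w| < η := by
  have hRc : (R : ℂ) ≠ 0 := by exact_mod_cast hR.ne'
  let e : AddCircle (2 * Real.pi) → ℂ := fun t => R * (t.toCircle : ℂ)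
  have he : Continuous e := by
    have := AddCircle.continuous_toCircle (T := 2 * Real.pi)
    fun_prop
  have hes : ∀ t, e t ∈ Metric.sphere (0 : ℂ) R := fun t => by
    rw [mem_sphere_zero_iff_norm, norm_mul, Circle.norm_coe, mul_one, Complex.norm_real,
      Real.norm_of_nonneg hR.le]
  let b : C(AddCircle (2 * Real.pi), ℂ) :=
    ⟨fun t => (v (e t) : ℂ), Complex.continuous_ofReal.comp (hv.comp_continuous he hes)⟩
  have hb : b ∈ (Submodule.span ℂ (Set.range (fourier (T := 2 * Real.pi)))).topologicalClosure := by
    rw [span_fourier_closure_eq_top]; trivial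
  rw [← SetLike.mem_coe, Submodule.topologicalClosure_coe, Metric.mem_closure_iff] at hb
  obtain ⟨x, hx, hxb⟩ := hb η hη
  -- Negative frequencies are conjugates of powers, so a trigonometric polynomial is `q₁ + conj q₂`
  -- on the circle, with the same real part as the entire function `q₁ + q₂`.
  have key : ∃ q₁ q₂ : ℂ → ℂ, Differentiable ℂ q₁ ∧ Differentiable ℂ q₂ ∧
      ∀ t, x t = q₁ (e t) + (starRingEnd ℂ) (q₂ (e t)) := by
    clear hxb
    rw [SetLike.mem_coe] at hx
    induction hx using Submodule.span_induction with
    | mem x hx =>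
      obtain ⟨n, rfl⟩ := hx
      have hdiv : ∀ t, e t / R = (t.toCircle : ℂ) := fun t => mul_div_cancel_left₀ _ hRc
      obtain ⟨m, rfl | rfl⟩ := n.eq_nat_or_neg
      · refine ⟨fun w => (w / R) ^ m, fun _ => 0, by fun_prop, by fun_prop, fun t => ?_⟩
        simp only [hdiv, map_zero, add_zero]
        simp [fourier_apply, AddCircle.toCircle_nsmul]
      · refine ⟨fun _ => 0, fun w => (w / R) ^ m, by fun_prop, by fun_prop, fun t => ?_⟩
        simp only [hdiv, zero_add]
        rw [fourier_neg]
        simp [fourier_apply, AddCircle.toCircle_nsmul]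
    | zero => exact ⟨fun _ => 0, fun _ => 0, by fun_prop, by fun_prop, by simp⟩
    | add x y _ _ hx hy =>
      obtain ⟨a, b, ha, hb, hab⟩ := hx
      obtain ⟨a', b', ha', hb', hab'⟩ := hy
      refine ⟨fun w => a w + a' w, fun w => b w + b' w, by fun_prop, by fun_prop, fun t => ?_⟩
      rw [ContinuousMap.add_apply, hab, hab', map_add]
      ring
    | smul c x _ hx =>
      obtain ⟨a, b, ha, hb, hab⟩ := hx
      refine ⟨fun w => c * a w, fun w => (starRingEnd ℂ) c * b w, by fun_prop, by fun_prop,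
        fun t => ?_⟩
      rw [ContinuousMap.smul_apply, hab, map_mul, Complex.conj_conj, smul_eq_mul]
      ring
  obtain ⟨q₁, q₂, h₁, h₂, hq⟩ := key
  refine ⟨fun w => q₁ w + q₂ w, by fun_prop, fun w hw => ?_⟩
  have hwt : e ((Complex.arg w : ℝ) : AddCircle (2 * Real.pi)) = w := by
    have h := Complex.norm_mul_exp_arg_mul_I w
    rw [mem_sphere_zero_iff_norm] at hw
    rw [hw] at h
    simpa [e, AddCircle.toCircle_apply_mk, Circle.coe_exp] using h
  set t : AddCircle (2 * Real.pi) := ((Complex.arg w : ℝ) : AddCircle (2 * Real.pi))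
  have h3 : dist (b t) (x t) < η := (ContinuousMap.dist_apply_le_dist t).trans_lt hxb
  rw [dist_comm, dist_eq_norm] at h3
  refine lt_of_le_of_lt ?_ h3
  have h4 : (q₁ w + q₂ w).re - v w = (x t - b t).re := by
    rw [hq, hwt]
    simp [b, hwt]
  rw [h4]
  exact Complex.abs_re_le_norm _

/-- A Harnack type bound for the subharmonic function `log (1 + |u|)`. -/
theorem log_one_add_norm_le {u : ℂ → ℂ} {R : ℝ} (hR : 0 < R)
    (hu : DiffContOnCl ℂ u (Metric.ball 0 R)) {w : ℂ} (hw : w ∈ Metric.ball 0 R) :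
    Real.log (1 + ‖u w‖) ≤
      (R + ‖w‖) / (R - ‖w‖) * Real.circleAverage (fun z => Real.log (1 + ‖u z‖)) 0 R := by
  have hwR : ‖w‖ < R := by simpa using hw
  set K := (R + ‖w‖) / (R - ‖w‖)
  have hK : 0 ≤ K := div_nonneg (by positivity) (by linarith)
  set A := Real.circleAverage (fun z => Real.log (1 + ‖u z‖)) 0 R
  have hus : ContinuousOn u (Metric.sphere 0 R) := by
    refine hu.continuousOn.mono ?_
    rw [closure_ball _ hR.ne']
    exact Metric.sphere_subset_closedBall
  have hvs : ContinuousOn (fun z => Real.log (1 + ‖u z‖)) (Metric.sphere 0 R) :=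
    ContinuousOn.log (continuousOn_const.add hus.norm) fun z _ => by positivity
  have main : ∀ η > 0, Real.log (1 + ‖u w‖) ≤ K * (A + 2 * η) := by
    intro η hη
    -- `Re q` serves as an approximate harmonic majorant. The shift by `η` puts it above `log (1 +
    -- |u|)` on the circle, hence also makes it nonnegative there.
    obtain ⟨q₀, hq₀, hqv⟩ := exists_differentiable_re_near hR hvs hη
    let q : ℂ → ℂ := fun z => q₀ z + η
    have hq : Differentiable ℂ q := by fun_prop
    have hlow : ∀ z ∈ Metric.sphere (0 : ℂ) R, Real.log (1 + ‖u z‖) ≤ (q z).re := by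
      intro z hz
      have := (abs_lt.1 (hqv z hz)).1
      simp only [q, Complex.add_re, Complex.ofReal_re]
      linarith
    have hupp : ∀ z ∈ Metric.sphere (0 : ℂ) R, (q z).re ≤ Real.log (1 + ‖u z‖) + 2 * η := by
      intro z hz
      have := (abs_lt.1 (hqv z hz)).2
      simp only [q, Complex.add_re, Complex.ofReal_re]
      linarith
    -- The unimodular `a` turns `1 + a u(w)` into `1 + |u(w)|`, so the maximum principle for `(1 + a
    -- u) e^{-q}` replaces the theory of subharmonic functions.
    obtain ⟨a, ha, hau⟩ := Complex.exists_norm_eq_mul_self (u w)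
    have h1 : ‖(1 + a * u w) * Complex.exp (-q w)‖ ≤ 1 := by
      refine Complex.norm_le_of_forall_mem_frontier_norm_le (U := Metric.ball (0 : ℂ) R)
        (f := fun z => (1 + a * u z) * Complex.exp (-q z)) Metric.isBounded_ball ?_ ?_
        (subset_closure hw)
      · exact DiffContOnCl.smul (diffContOnCl_const.add (hu.const_smul a))
          (hq.neg.cexp.diffContOnCl)
      · intro z hz
        rw [frontier_ball _ hR.ne'] at hz
        rw [norm_mul, Complex.norm_exp, Complex.neg_re, Real.exp_neg, ← div_eq_mul_inv,
          div_le_one (Real.exp_pos _)]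
        calc ‖1 + a * u z‖ ≤ 1 + ‖u z‖ := by
              refine (norm_add_le _ _).trans ?_
              simp [ha]
          _ = Real.exp (Real.log (1 + ‖u z‖)) := (Real.exp_log (by positivity)).symm
          _ ≤ _ := Real.exp_le_exp.2 (hlow z hz)
    have h2 : Real.log (1 + ‖u w‖) ≤ (q w).re := by
      rw [← hau, norm_mul, Complex.norm_exp, Complex.neg_re, Real.exp_neg, ← div_eq_mul_inv,
        div_le_one (Real.exp_pos _)] at h1
      rw [Real.log_le_iff_le_exp (by positivity)]
      refine le_trans (le_of_eq ?_) h1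
      rw [← Complex.ofReal_one, ← Complex.ofReal_add, Complex.norm_real, Real.norm_of_nonneg]
      positivity
    have hqc : ContinuousOn (fun z => (q z).re) (Metric.sphere 0 R) :=
      (Complex.continuous_re.comp hq.continuous).continuousOn
    have hqi : CircleIntegrable (fun z => (q z).re) 0 R := hqc.circleIntegrable hR.le
    have hR' : Metric.sphere (0 : ℂ) |R| = Metric.sphere 0 R := by rw [abs_of_pos hR]
    have hkc : ContinuousOn (fun z => (herglotzRieszKernel 0 w z).re) (Metric.sphere 0 R) :=
      Complex.continuous_re.comp_continuousOn (hR' ▸ continuousOn_herglotzRieszKernel_sphere hw)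
    have h3 : (q w).re
        = Real.circleAverage (fun z => (herglotzRieszKernel 0 w z).re * (q z).re) 0 R := by
      rw [← (hq.diffContOnCl (s := Metric.ball 0 R)).circleAverage_re_herglotzRieszKernel_smul hw]
      have := Complex.reCLM.circleAverage_comp_comm
        (f := Complex.re ∘ herglotzRieszKernel 0 w • q) (c := 0) (R := R)
        ((hkc.smul hq.continuous.continuousOn).circleIntegrable hR.le)
      rw [Complex.reCLM_apply] at this
      rw [← this]
      congr 1
      funext z
      simp
    -- Harnack: the Poisson kernel is at most `K`, and `Re q ≥ 0` on the circle.
    have h4 : (q w).re ≤ Real.circleAverage (fun z => K * (q z).re) 0 R := by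
      rw [h3]
      refine Real.circleAverage_mono ((hkc.mul hqc).circleIntegrable hR.le)
        ((continuousOn_const.mul hqc).circleIntegrable hR.le) fun z hz => ?_
      rw [hR'] at hz
      refine mul_le_mul_of_nonneg_right ?_ ((log_nonneg' _).trans (hlow z hz))
      have := re_herglotzRieszKernel_le hz hw
      simpa [herglotzRieszKernel_def, K] using this
    have h5 : Real.circleAverage (fun z => K * (q z).re) 0 R ≤ K * (A + 2 * η) := by
      have := Real.circleAverage_fun_smul (a := K) (f := fun z => (q z).re) (c := 0) (R := R)
      simp only [smul_eq_mul] at this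
      rw [this]
      refine mul_le_mul_of_nonneg_left ?_ hK
      have h6 := Real.circleAverage_fun_add (hvs.circleIntegrable hR.le)
        (circleIntegrable_const (2 * η) 0 R)
      rw [Real.circleAverage_const] at h6
      rw [← h6]
      refine Real.circleAverage_mono hqi ((hvs.add continuousOn_const).circleIntegrable hR.le)
        fun z hz => hupp z (hR' ▸ hz)
    linarith
  have ht : Filter.Tendsto (fun η : ℝ => K * (A + 2 * η)) (𝓝[>] 0) (𝓝 (K * A)) := by
    have : Continuous fun η : ℝ => K * (A + 2 * η) := by fun_prop
    simpa using (this.tendsto 0).mono_left nhdsWithin_le_nhds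
  exact ge_of_tendsto ht (by filter_upwards [self_mem_nhdsWithin] with η hη using main η hη)

/-- Growth of the Taylor coefficients of a function on the disc with small logarithmic means. -/
theorem norm_iteratedDeriv_le_of_circleAverage_le {u : ℂ → ℂ}
    (hu : DifferentiableOn ℂ u (Metric.ball 0 1)) {ε δ : ℝ} (hδ : 0 < δ) (hδ' : δ ≤ 1 / 2)
    (hε : ε ≤ δ ^ 2 / 4)
    (h : ∀ r ∈ Set.Ioo (0 : ℝ) 1,
      Real.circleAverage (fun z => Real.log (1 + ‖u z‖)) 0 r ≤ ε) (n : ℕ) :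
    ‖iteratedDeriv n u 0‖ ≤ n.factorial *
      (4 * ε / δ * (Real.sqrt (n + 1) * Real.exp (3 * δ * Real.sqrt (n + 1)))) := by
  have hε0 : 0 ≤ ε :=
    (Real.circleAverage_nonneg_of_nonneg fun _ _ => log_nonneg' _).trans (h (1 / 2) (by norm_num))
  -- The radius `1 - δ/s` balances the growth `e^{O(ε s/δ)}` of `u` against the factor `ρ^{-n}`; `n
  -- + 1` instead of `n` keeps `s ≥ 1`.
  set s := Real.sqrt (n + 1) with hs
  have hs1 : 1 ≤ s := Real.one_le_sqrt.2 (by linarith [Nat.cast_nonneg (α := ℝ) n])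
  have hss : s * s = n + 1 := Real.mul_self_sqrt (by positivity)
  have hδs : δ / s ≤ 1 / 2 := (div_le_self hδ.le hs1).trans hδ'
  have hδs0 : 0 < δ / s := by positivity
  set ρ := 1 - δ / s
  have hρ : 1 / 2 ≤ ρ := by simp only [ρ]; linarith
  have hρ1 : ρ < 1 := by simp only [ρ]; linarith
  set x := 4 * ε / δ * s
  have hx0 : 0 ≤ x := by positivity
  have hpt : ∀ w ∈ Metric.sphere (0 : ℂ) ρ, ‖u w‖ ≤ x * Real.exp x := by
    intro w hw
    rw [mem_sphere_zero_iff_norm] at hw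
    set R := (1 + ρ) / 2
    have hR : R ∈ Set.Ioo (0 : ℝ) 1 := ⟨by simp only [R]; linarith, by simp only [R]; linarith⟩
    have hsub : Metric.closedBall (0 : ℂ) R ⊆ Metric.ball 0 1 := Metric.closedBall_subset_ball hR.2
    have hwR : ‖w‖ < R := by rw [hw]; simp only [R]; linarith
    have h1 := log_one_add_norm_le hR.1 (hu.diffContOnCl_ball hsub) (w := w) (by simpa using hwR)
    have h2 : (R + ‖w‖) / (R - ‖w‖) ≤ 4 * s / δ := by
      rw [hw]
      have : R - ρ = δ / s / 2 := by simp only [R, ρ]; ring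
      rw [this]
      calc (R + ρ) / (δ / s / 2) ≤ 2 / (δ / s / 2) := by
            gcongr
            linarith [hR.2]
        _ = _ := by field_simp; norm_num
    have h3 : Real.log (1 + ‖u w‖) ≤ x := by
      calc _ ≤ _ := h1
        _ ≤ 4 * s / δ * ε := by
            refine mul_le_mul h2 (h R hR)
              (Real.circleAverage_nonneg_of_nonneg fun _ _ => log_nonneg' _) (by positivity)
        _ = x := by simp only [x]; ring
    -- From `|u| ≤ e^x - 1 ≤ x e^x`: the factor `x` keeps the bound proportional to `ε`.
    rw [Real.log_le_iff_le_exp (by positivity)] at h3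
    have h4 := Real.add_one_le_exp (-x)
    have h5 : Real.exp x * Real.exp (-x) = 1 := by rw [← Real.exp_add]; simp
    nlinarith [Real.exp_pos x]
  have hc := Complex.norm_iteratedDeriv_le_of_forall_mem_sphere_norm_le (c := 0) (R := ρ) n
    (by linarith) (hu.diffContOnCl_ball (Metric.closedBall_subset_ball hρ1)) hpt
  refine hc.trans ?_
  rw [mul_div_assoc]
  refine mul_le_mul_of_nonneg_left ?_ (by positivity)
  have hpow : (ρ ^ n)⁻¹ ≤ Real.exp (2 * δ * s) := by
    have h1 : ρ⁻¹ ≤ Real.exp (2 * (δ / s)) := by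
      have := Real.add_one_le_exp (2 * (δ / s))
      refine le_trans ?_ this
      rw [inv_le_iff_one_le_mul₀ (by linarith)]
      simp only [ρ]
      nlinarith
    calc (ρ ^ n)⁻¹ = ρ⁻¹ ^ n := (inv_pow _ _).symm
      _ ≤ Real.exp (2 * (δ / s)) ^ n := by gcongr
      _ = Real.exp (n * (2 * (δ / s))) := (Real.exp_nat_mul _ _).symm
      _ ≤ Real.exp (2 * δ * s) := by
          refine Real.exp_le_exp.2 ?_
          have : 2 * δ * s = (s * s) * (2 * (δ / s)) := by field_simp
          rw [this, hss]
          nlinarith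
  -- Here `ε ≤ δ²/4` enters. Only the exponent is simplified; the prefactor `x` retains its `ε`.
  have hxs : x ≤ δ * s := by
    simp only [x]
    refine mul_le_mul_of_nonneg_right ?_ (by positivity)
    rw [div_le_iff₀ hδ]
    nlinarith
  calc x * Real.exp x / ρ ^ n = x * (Real.exp x * (ρ ^ n)⁻¹) := by ring
    _ ≤ x * (Real.exp (δ * s) * Real.exp (2 * δ * s)) := by gcongr
    _ = _ := by
      rw [← Real.exp_add]
      simp only [x]
      ring_nf

end Disc
-- From slices to Taylor coefficients on the ball
section Slices

variable {d : ℕ}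

theorem iteratedFDeriv_comp_diagonal {E : Type*} [NormedAddCommGroup E] [NormedSpace ℂ E]
    {f : Cd d → ℂ} (hf : AnalyticAt ℂ f 0) (L : E →L[ℂ] Cd d) (n : ℕ) (y : E) :
    iteratedFDeriv ℂ n (f ∘ L) 0 (fun _ => y) = iteratedFDeriv ℂ n f 0 fun _ => L y := by
  obtain ⟨p, r, hp⟩ := hf
  have h0 : L 0 = 0 := map_zero L
  have hp' : HasFPowerSeriesAt f p (L 0) := by rw [h0]; exact ⟨r, hp⟩
  obtain ⟨r', hq⟩ := hp'.compContinuousLinearMap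
  rw [← hq.factorial_smul y n, ← hp.factorial_smul (L y) n]
  rfl

/-- The derivatives at the origin of the slice functions `w ↦ f (w ζ)`. -/
theorem iteratedDeriv_slice {f : Cd d → ℂ} (hf : AnalyticAt ℂ f 0) (n : ℕ) (ζ : Cd d) :
    iteratedDeriv n (fun w : ℂ => f (w • ζ)) 0 = n.factorial * homogPart f n ζ := by
  rw [factorial_mul_homogPart hf, iteratedDeriv_eq_iteratedFDeriv]
  have h := iteratedFDeriv_comp_diagonal hf (ContinuousLinearMap.toSpanSingleton ℂ ζ) n 1
  simpa [Function.comp_def] using h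

/-- Transfers estimates from `f_r - f`, which has small gauge for `f` in `N_u^+`, back to `f`. -/
theorem homogPart_dilation_sub {f : Cd d → ℂ} (hf : AnalyticAt ℂ f 0) (r : ℝ) (n : ℕ)
    (z : Cd d) :
    homogPart (fun z => f (r • z) - f z) n z = ((r : ℂ) ^ n - 1) * homogPart f n z := by
  let L : Cd d →L[ℂ] Cd d := (r : ℂ) • ContinuousLinearMap.id ℂ (Cd d)
  have hL : ∀ z, L z = r • z := fun z => by
    change (r : ℂ) • z = r • z
    exact Complex.coe_smul r z
  have h0 : L 0 = 0 := map_zero L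
  have hfL : AnalyticAt ℂ (f ∘ L) 0 := (h0.symm ▸ hf : AnalyticAt ℂ f (L 0)).comp (L.analyticAt 0)
  have hfun : (fun z => f (r • z) - f z) = f ∘ L + -f := by
    funext z
    simp [hL, sub_eq_add_neg]
  have hn : (n.factorial : ℂ) ≠ 0 := by exact_mod_cast Nat.factorial_ne_zero n
  refine mul_left_cancel₀ hn ?_
  rw [hfun, factorial_mul_homogPart (hfL.add hf.neg),
    iteratedFDeriv_add_apply hfL.contDiffAt hf.neg.contDiffAt]
  rw [iteratedFDeriv_neg_apply, add_apply, iteratedFDeriv_comp_diagonal hf,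
    neg_apply]
  have h2 : (fun _ : Fin n => L z) = fun _ : Fin n => (r : ℂ) • z := rfl
  rw [h2, ContinuousMultilinearMap.map_smul_univ _ (fun _ => (r : ℂ)) (fun _ => z)]
  rw [← factorial_mul_homogPart hf]
  simp
  ring

theorem differentiableOn_slice {f : Cd d → ℂ} (hf : AnalyticOnNhd ℂ f (unitBall d)) {ζ : Cd d}
    (hζ : ‖ζ‖ = 1) : DifferentiableOn ℂ (fun w : ℂ => f (w • ζ)) (Metric.ball 0 1) := by
  refine hf.differentiableOn.comp (by fun_prop) fun w hw => ?_
  simpa [norm_smul, hζ] using hw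

theorem norm_homogPart_le {f : Cd d → ℂ} (hf : AnalyticOnNhd ℂ f (unitBall d)) {ε δ : ℝ}
    (hδ : 0 < δ) (hδ' : δ ≤ 1 / 2) (hε0 : 0 ≤ ε) (hε : ε ≤ δ ^ 2 / 4)
    (h : logGauge f ≤ ENNReal.ofReal ε) (n : ℕ) {ζ : Cd d} (hζ : ‖ζ‖ = 1) :
    ‖homogPart f n ζ‖ ≤ 4 * ε / δ * (Real.sqrt (n + 1) * Real.exp (3 * δ * Real.sqrt (n + 1))) := by
  have h1 := norm_iteratedDeriv_le_of_circleAverage_le (differentiableOn_slice hf hζ) hδ hδ' hε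
    (fun r hr => (ENNReal.ofReal_le_ofReal_iff hε0).1
      ((circleAverage_le_logGauge f (by simpa using hζ) hr).trans h)) n
  rw [iteratedDeriv_slice (hf 0 (by simp)), norm_mul, RCLike.norm_natCast] at h1
  exact le_of_mul_le_mul_left h1 (by positivity)

/-- The growth function in the estimate of the Taylor coefficients. -/
noncomputable def coeffGrowth (d : ℕ) (δ : ℝ) (n : ℕ) : ℝ :=
  (Real.exp 1 * (n + 1)) ^ d * (Real.sqrt (n + 1) * Real.exp (3 * δ * Real.sqrt (n + 1)))

theorem one_le_coeffGrowth {δ : ℝ} (hδ : 0 < δ) (n : ℕ) : 1 ≤ coeffGrowth d δ n := by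
  have h0 : (0 : ℝ) ≤ n := Nat.cast_nonneg n
  have h1 : (1 : ℝ) ≤ Real.exp 1 * (n + 1) := by
    have := Real.add_one_le_exp (1 : ℝ)
    nlinarith
  have h2 : (1 : ℝ) ≤ Real.sqrt (n + 1) := Real.one_le_sqrt.2 (by linarith)
  have h3 : 1 ≤ Real.exp (3 * δ * Real.sqrt (n + 1)) := Real.one_le_exp (by positivity)
  exact one_le_mul_of_one_le_of_one_le (one_le_pow₀ h1) (one_le_mul_of_one_le_of_one_le h2 h3)

/-- The Cauchy estimate on the torus through the point of `exists_omega_le`, which lies in the unit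
sphere. -/
theorem norm_taylorCoeff_mul_omega_le [NeZero d] {f : Cd d → ℂ} {α : Fin d → ℕ} {C : ℝ}
    (hC : ∀ ζ : Cd d, ‖ζ‖ = 1 → ‖homogPart f (length α) ζ‖ ≤ C) :
    ‖taylorCoeff f α‖ * omega α ≤ (Real.exp 1 * (length α + 1)) ^ d * C := by
  obtain ⟨r, hr, hr1, hω⟩ := exists_omega_le α
  have h := norm_taylorCoeff_mul_le f (α := α) hr (C := C) fun z hz => hC z (by
    rw [EuclideanSpace.norm_eq, Finset.sum_congr rfl fun i _ => by rw [hz i], hr1, Real.sqrt_one])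
  calc _ ≤ ‖taylorCoeff f α‖ * ((Real.exp 1 * (length α + 1)) ^ d * ∏ i, r i ^ α i) := by gcongr
    _ = (Real.exp 1 * (length α + 1)) ^ d * (‖taylorCoeff f α‖ * ∏ i, r i ^ α i) := by ring
    _ ≤ _ := by gcongr

theorem norm_taylorCoeff_mul_omega_le_of_logGauge_le [NeZero d] {f : Cd d → ℂ}
    (hf : AnalyticOnNhd ℂ f (unitBall d)) {ε δ : ℝ}
    (hδ : 0 < δ) (hδ' : δ ≤ 1 / 2) (hε0 : 0 ≤ ε) (hε : ε ≤ δ ^ 2 / 4)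
    (h : logGauge f ≤ ENNReal.ofReal ε) (α : Fin d → ℕ) :
    ‖taylorCoeff f α‖ * omega α ≤ 4 * ε / δ * coeffGrowth d δ (length α) := by
  refine (norm_taylorCoeff_mul_omega_le fun ζ hζ =>
    norm_homogPart_le hf hδ hδ' hε0 hε h (length α) hζ).trans (le_of_eq ?_)
  rw [coeffGrowth]
  ring

theorem analyticOnNhd_dilation_sub {f : Cd d → ℂ} (hf : AnalyticOnNhd ℂ f (unitBall d)) {r : ℝ}
    (hr : r ∈ Set.Ioo (0 : ℝ) 1) :
    AnalyticOnNhd ℂ (fun z => f (r • z) - f z) (unitBall d) := by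
  refine AnalyticOnNhd.sub (fun z hz => ?_) hf
  have hrz : (r : ℂ) • z ∈ unitBall d := by
    simp only [mem_ball_zero_iff] at hz ⊢
    rw [norm_smul, Complex.norm_real, Real.norm_of_nonneg hr.1.le]
    nlinarith [hr.1, hr.2, norm_nonneg z]
  have h1 : AnalyticAt ℂ (fun z : Cd d => (r : ℂ) • z) z := analyticAt_const.fun_smul analyticAt_id
  have h2 := (hf _ hrz).comp_of_eq h1 rfl
  simpa [Function.comp_def] using h2

/-- Taylor coefficients of functions in `N_u^+` grow slower than `ω_α⁻¹ e^{c √|α|}` for each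
positive `c`. -/
theorem MemNuPlus.exists_norm_taylorCoeff_le [NeZero d] {f : Cd d → ℂ} (hf : MemNuPlus f)
    {δ : ℝ} (hδ : 0 < δ) (hδ' : δ ≤ 1 / 2) :
    ∃ C : ℝ, ∀ α, ‖taylorCoeff f α‖ * omega α ≤ C * coeffGrowth d δ (length α) := by
  have hpos : 0 < δ ^ 2 / 4 := by positivity
  obtain ⟨r, hrε, hr⟩ := ((hf.2.eventually_lt_const (ENNReal.ofReal_pos.2 hpos)).and
    eventually_Ioo).exists
  have h0 := hf.1.1.1 0 (by simp)
  have hr1 : 0 < 1 - r := by linarith [hr.2]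
  -- In degree `0` the factor `r^n - 1` vanishes, so that coefficient is treated separately; in
  -- positive degree `1 - r^n ≥ 1 - r`.
  refine ⟨max (δ / (1 - r)) ‖taylorCoeff f 0‖, fun α => ?_⟩
  have hG := one_le_coeffGrowth (d := d) hδ (length α)
  rcases Nat.eq_zero_or_pos (length α) with hα | hα
  · have hα0 : α = 0 := by
      funext i
      have : α i ≤ length α :=
        Finset.single_le_sum (fun _ _ => Nat.zero_le _) (Finset.mem_univ i)
      simp only [Pi.zero_apply]
      omega
    have : omega (0 : Fin d → ℕ) = 1 := by simp [omega, factorial, length]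
    subst hα0
    rw [this, mul_one]
    exact (le_max_right _ _).trans (le_mul_of_one_le_right
      ((norm_nonneg _).trans (le_max_right _ _)) hG)
  · have hle : ∀ ζ : Cd d, ‖ζ‖ = 1 → ‖homogPart f (length α) ζ‖ ≤ δ / (1 - r) *
        (Real.sqrt (length α + 1) * Real.exp (3 * δ * Real.sqrt (length α + 1))) := by
      intro ζ hζ
      have h1 := norm_homogPart_le (analyticOnNhd_dilation_sub hf.1.1.1 hr) hδ hδ' hpos.le le_rfl
        hrε.le (length α) hζ
      rw [homogPart_dilation_sub h0, norm_mul] at h1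
      have h2 : 1 - r ≤ ‖(r : ℂ) ^ length α - 1‖ := by
        rw [← Complex.ofReal_pow, ← Complex.ofReal_one, ← Complex.ofReal_sub, Complex.norm_real,
          Real.norm_eq_abs, abs_sub_comm]
        refine le_trans ?_ (le_abs_self _)
        have := pow_le_of_le_one hr.1.le hr.2.le hα.ne'
        linarith
      have h3 : 4 * (δ ^ 2 / 4) / δ = δ := by field_simp
      rw [h3] at h1
      rw [div_mul_eq_mul_div, le_div_iff₀ hr1]
      refine le_trans ?_ h1
      rw [mul_comm]
      gcongr
    calc _ ≤ _ := norm_taylorCoeff_mul_omega_le hle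
      _ = δ / (1 - r) * coeffGrowth d δ (length α) := by rw [coeffGrowth]; ring
      _ ≤ _ := by
        gcongr
        exact le_max_left _ _

end Slices

/-! ### Sufficiency: absolute convergence and continuity -/

section Sufficiency

variable {d : ℕ}

/-- One term of the exponential series at `c (√n + 1)` dominates, since `n + 1 ≤ (√n + 1)²`. -/
theorem exists_pow_mul_exp_neg_sqrt_le (k : ℕ) {c : ℝ} (hc : 0 < c) :
    ∃ C > (0 : ℝ), ∀ n : ℕ, ((n : ℝ) + 1) ^ k * Real.exp (-c * Real.sqrt n) ≤ C := by
  refine ⟨(2 * k).factorial / c ^ (2 * k) * Real.exp c, by positivity, fun n => ?_⟩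
  set s := Real.sqrt n
  have hs : 0 ≤ s := Real.sqrt_nonneg _
  have hss : s ^ 2 = n := Real.sq_sqrt (Nat.cast_nonneg n)
  have h1 := Real.pow_div_factorial_le_exp (c * (s + 1)) (by positivity) (2 * k)
  have h2 : ((n : ℝ) + 1) ^ k ≤ (s + 1) ^ (2 * k) := by
    rw [pow_mul]
    refine pow_le_pow_left₀ (by positivity) ?_ _
    nlinarith
  rw [mul_pow, div_le_iff₀ (by positivity)] at h1
  have h3 : (s + 1) ^ (2 * k) ≤ (2 * k).factorial / c ^ (2 * k) * Real.exp (c * (s + 1)) := by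
    rw [div_mul_eq_mul_div, le_div_iff₀ (by positivity)]
    linarith
  calc _ ≤ (2 * k).factorial / c ^ (2 * k) * Real.exp (c * (s + 1)) * Real.exp (-c * s) := by
        gcongr
        exact h2.trans h3
    _ = _ := by
        rw [mul_assoc, ← Real.exp_add]
        ring_nf

/-- A finite set of multi-indices lies in a box, over which the sum factors into one-dimensional
sums. -/
theorem summable_prod_inv_sq (d : ℕ) :
    Summable fun α : Fin d → ℕ => ∏ i, (((α i : ℝ) + 1) ^ 2)⁻¹ := by
  classical
  have h1 : Summable fun j : ℕ => (((j : ℝ) + 1) ^ 2)⁻¹ := by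
    have := (summable_nat_add_iff 1).2 (Real.summable_nat_pow_inv.2 (by norm_num : 1 < 2))
    simpa using this
  refine summable_of_sum_le (c := (∑' j : ℕ, (((j : ℝ) + 1) ^ 2)⁻¹) ^ d)
    (fun α => Finset.prod_nonneg fun i _ => by positivity) fun S => ?_
  let N := S.sup (fun β => Finset.univ.sup β) + 1
  have hS : S ⊆ Fintype.piFinset fun _ : Fin d => Finset.range N := by
    intro β hβ
    refine Fintype.mem_piFinset.2 fun i => Finset.mem_range.2 (Nat.lt_succ_of_le ?_)
    exact (Finset.le_sup (f := β) (Finset.mem_univ i)).trans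
      (Finset.le_sup (f := fun β : Fin d → ℕ => Finset.univ.sup β) hβ)
  calc _ ≤ ∑ α ∈ Fintype.piFinset fun _ : Fin d => Finset.range N,
        ∏ i, (((α i : ℝ) + 1) ^ 2)⁻¹ :=
        Finset.sum_le_sum_of_subset_of_nonneg hS fun _ _ _ =>
          Finset.prod_nonneg fun i _ => by positivity
    _ = ∏ _i : Fin d, ∑ j ∈ Finset.range N, (((j : ℝ) + 1) ^ 2)⁻¹ :=
        (Finset.prod_univ_sum (fun _ => Finset.range N)
          (fun _ (j : ℕ) => (((j : ℝ) + 1) ^ 2)⁻¹)).symm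
    _ ≤ ∏ _i : Fin d, ∑' j : ℕ, (((j : ℝ) + 1) ^ 2)⁻¹ := by
        refine Finset.prod_le_prod (fun _ _ => Finset.sum_nonneg fun _ _ => by positivity)
          fun _ _ => h1.sum_le_tsum _ fun _ _ => by positivity
    _ = _ := by simp

/-- As `3δ ≤ c/2`, half of the decay survives. It absorbs the polynomial factor of degree `d + 1`
and another of degree `2d`, whose inverse is at most `∏ (α_i + 1)^{-2}`. -/
theorem summable_exp_mul_coeffGrowth (d : ℕ) {δ c : ℝ} (hδ : 6 * δ ≤ c) (hc : 0 < c) :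
    Summable fun α : Fin d → ℕ =>
      Real.exp (-c * Real.sqrt (length α)) * coeffGrowth d δ (length α) := by
  obtain ⟨C, hC, h⟩ := exists_pow_mul_exp_neg_sqrt_le (d + 1 + 2 * d) (half_pos hc)
  refine Summable.of_nonneg_of_le (fun α => ?_) (fun α => ?_)
    ((summable_prod_inv_sq d).mul_left (Real.exp 1 ^ d * Real.exp (c / 2) * C))
  · rw [coeffGrowth]
    positivity
  set n := length α
  set s := Real.sqrt n
  have hn0 : (0 : ℝ) ≤ n := Nat.cast_nonneg n
  have hs : 0 ≤ s := Real.sqrt_nonneg _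
  have hss : s ^ 2 = n := Real.sq_sqrt hn0
  have h1 : Real.sqrt (n + 1) ≤ n + 1 := by
    rw [Real.sqrt_le_left (by positivity)]
    nlinarith
  have h2 : Real.sqrt (n + 1) ≤ s + 1 := by
    rw [Real.sqrt_le_left (by positivity)]
    nlinarith
  have h3 : Real.exp (3 * δ * Real.sqrt (n + 1)) ≤ Real.exp (c / 2) * Real.exp (c / 2 * s) := by
    rw [← Real.exp_add]
    refine Real.exp_le_exp.2 ?_
    nlinarith [Real.sqrt_nonneg ((n : ℝ) + 1)]
  have h4 : (((n : ℝ) + 1) ^ (2 * d))⁻¹ ≤ ∏ i, (((α i : ℝ) + 1) ^ 2)⁻¹ := by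
    rw [Finset.prod_inv_distrib]
    refine inv_anti₀ (Finset.prod_pos fun i _ => by positivity) ?_
    rw [pow_mul]
    calc _ ≤ ∏ _i : Fin d, ((n : ℝ) + 1) ^ 2 := by
          refine Finset.prod_le_prod (fun _ _ => by positivity) fun i _ => ?_
          have : (α i : ℝ) ≤ n := by
            exact_mod_cast Finset.single_le_sum (f := α) (fun _ _ => Nat.zero_le _)
              (Finset.mem_univ i)
          gcongr
      _ = _ := by simp
  calc Real.exp (-c * s) * coeffGrowth d δ n
      ≤ Real.exp (-c * s) * ((Real.exp 1 * (n + 1)) ^ d *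
        ((n + 1) * (Real.exp (c / 2) * Real.exp (c / 2 * s)))) := by
        rw [coeffGrowth]
        gcongr
    _ = Real.exp 1 ^ d * Real.exp (c / 2) * (((n : ℝ) + 1) ^ (d + 1) *
        (Real.exp (-c * s) * Real.exp (c / 2 * s))) := by
        rw [mul_pow, pow_succ]
        ring
    _ = Real.exp 1 ^ d * Real.exp (c / 2) * ((((n : ℝ) + 1) ^ (d + 1 + 2 * d) *
        Real.exp (-(c / 2) * s)) * (((n : ℝ) + 1) ^ (2 * d))⁻¹) := by
        rw [← Real.exp_add, pow_add _ (d + 1)]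
        have : -c * s + c / 2 * s = -(c / 2) * s := by ring
        rw [this]
        field_simp
    _ ≤ Real.exp 1 ^ d * Real.exp (c / 2) * (C * ∏ i, (((α i : ℝ) + 1) ^ 2)⁻¹) := by
        gcongr
        exact h n
    _ = _ := by ring

theorem taylorCoeff_add {f g : Cd d → ℂ} (hf : AnalyticAt ℂ f 0) (hg : AnalyticAt ℂ g 0)
    (α : Fin d → ℕ) : taylorCoeff (f + g) α = taylorCoeff f α + taylorCoeff g α := by
  rw [taylorCoeff, partialAtZero, iteratedFDeriv_add_apply hf.contDiffAt hg.contDiffAt,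
    add_apply, add_div]
  rfl

theorem taylorCoeff_smul {f : Cd d → ℂ} (hf : AnalyticAt ℂ f 0) (c : ℂ)
    (α : Fin d → ℕ) : taylorCoeff (c • f) α = c * taylorCoeff f α := by
  rw [taylorCoeff, partialAtZero, iteratedFDeriv_const_smul_apply hf.contDiffAt,
    smul_apply, smul_eq_mul, mul_div_assoc]
  rfl

theorem NuPlus.analyticAt_zero (f : NuPlus d) : AnalyticAt ℂ (f : Cd d → ℂ) 0 :=
  f.memNuPlus.1.1.1 0 (by simp)

theorem norm_mul_conj_le {a g : ℂ} {ω M E G C : ℝ} (hg : ‖g‖ ≤ M * ω * E)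
    (hM : 0 ≤ M) (hE : 0 ≤ E) (ha : ‖a‖ * ω ≤ C * G) :
    ‖a * (starRingEnd ℂ) g‖ ≤ C * M * (E * G) := by
  rw [norm_mul, RCLike.norm_conj]
  calc ‖a‖ * ‖g‖ ≤ ‖a‖ * (M * ω * E) := by gcongr
    _ = (M * E) * (‖a‖ * ω) := by ring
    _ ≤ (M * E) * (C * G) := by gcongr
    _ = _ := by ring

theorem DecayCondition.summable_norm [NeZero d] {γ : (Fin d → ℕ) → ℂ} (hγ : DecayCondition γ)
    (f : NuPlus d) : Summable fun α => ‖taylorCoeff f α * (starRingEnd ℂ) (γ α)‖ := by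
  obtain ⟨M, hM, c, hc, h⟩ := hγ
  obtain ⟨C, hC⟩ := f.memNuPlus.exists_norm_taylorCoeff_le (δ := min (1 / 2) (c / 6))
    (by positivity) (min_le_left _ _)
  refine Summable.of_nonneg_of_le (fun _ => norm_nonneg _) (fun α =>
    norm_mul_conj_le (h α) hM.le (Real.exp_pos _).le (hC α))
    ((summable_exp_mul_coeffGrowth d ?_ hc).mul_left (C * M))
  linarith [min_le_right (1 / 2) (c / 6)]

/-- The functional `f ↦ ∑ f̂(α) conj γ_α`. -/
noncomputable def DecayCondition.functional [NeZero d] {γ : (Fin d → ℕ) → ℂ}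
    (hγ : DecayCondition γ) : NuPlus d →ₗ[ℂ] ℂ where
  toFun f := ∑' α, taylorCoeff f α * (starRingEnd ℂ) (γ α)
  map_add' f g := by
    rw [← (hγ.summable_norm f).of_norm.tsum_add (hγ.summable_norm g).of_norm]
    refine tsum_congr fun α => ?_
    change taylorCoeff ((f : Cd d → ℂ) + (g : Cd d → ℂ)) α * _ = _
    rw [taylorCoeff_add f.analyticAt_zero g.analyticAt_zero, add_mul]
  map_smul' c f := by
    rw [RingHom.id_apply, smul_eq_mul, ← tsum_mul_left]
    refine tsum_congr fun α => ?_
    change taylorCoeff (c • (f : Cd d → ℂ)) α * _ = _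
    rw [taylorCoeff_smul f.analyticAt_zero, mul_assoc]

theorem DecayCondition.hasSum [NeZero d] {γ : (Fin d → ℕ) → ℂ} (hγ : DecayCondition γ)
    (f : NuPlus d) :
    HasSum (fun α => taylorCoeff f α * (starRingEnd ℂ) (γ α)) (hγ.functional f) :=
  (hγ.summable_norm f).of_norm.hasSum

/-- The coefficient bound applied to `f - g` is linear in `ρ(f, g)` once `ρ(f, g) ≤ δ²/4`, so the
functional is Lipschitz at small distances. -/
theorem DecayCondition.continuous_functional [NeZero d] {γ : (Fin d → ℕ) → ℂ}
    (hγ : DecayCondition γ) : Continuous hγ.functional := by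
  have hbound : ∃ K ≥ (0 : ℝ), ∃ ε₀ > (0 : ℝ), ∀ f g : NuPlus d, dist f g ≤ ε₀ →
      dist (hγ.functional f) (hγ.functional g) ≤ K * dist f g := by
    obtain ⟨M, hM, c, hc, h⟩ := id hγ
    set δ := min (1 / 2) (c / 6)
    have hδ : 0 < δ := by positivity
    have hs := summable_exp_mul_coeffGrowth d (δ := δ) (c := c)
      (by linarith [min_le_right (1 / 2) (c / 6)]) hc
    set B := ∑' α : Fin d → ℕ, Real.exp (-c * Real.sqrt (length α)) * coeffGrowth d δ (length α)
    have hB : 0 ≤ B := tsum_nonneg fun α => by rw [coeffGrowth]; positivity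
    refine ⟨4 / δ * M * B, by positivity, δ ^ 2 / 4, by positivity, fun f g hfg => ?_⟩
    have hle : logGauge (f - g : NuPlus d) ≤ ENNReal.ofReal (dist f g) := by
      rw [NuPlus.dist_def, ENNReal.ofReal_toReal (NuPlus.logGauge_sub_ne_top f g)]
      exact le_rfl
    rw [dist_eq_norm, ← map_sub]
    refine (tsum_of_norm_bounded (hs.hasSum.mul_left (4 * dist f g / δ * M)) fun α =>
      norm_mul_conj_le (h α) hM.le (Real.exp_pos _).le
        (norm_taylorCoeff_mul_omega_le_of_logGauge_le (f - g).memNuPlus.1.1.1 hδ (min_le_left _ _)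
          dist_nonneg hfg hle α)).trans (le_of_eq ?_)
    ring
  obtain ⟨K, hK, ε₀, hε₀, hb⟩ := hbound
  refine Metric.continuous_iff.2 fun g ε hε => ⟨min ε₀ (ε / (K + 1)), by positivity,
    fun f hf => ?_⟩
  have h1 : dist f g < ε / (K + 1) := hf.trans_le (min_le_right _ _)
  rw [lt_div_iff₀ (by positivity)] at h1
  have := hb f g (hf.le.trans (min_le_left _ _))
  nlinarith [dist_nonneg (x := f) (y := g)]

end Sufficiency
-- Polynomials with small gauge and a large coefficient
section TestPolynomial

open Polynomial

/-- The polynomial `1 + 2 (X + ⋯ + X^i)`, whose real part on the circle is the Dirichlet kernel. -/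
noncomputable def dirichletPoly (i : ℕ) : ℝ[X] :=
  1 + ∑ j ∈ Finset.range i, C 2 * X ^ (j + 1)

/-- The polynomial whose real part on the circle is the Fejér kernel of order `m`. -/
noncomputable def fejerPoly (m : ℕ) : ℝ[X] :=
  C (m : ℝ)⁻¹ * ∑ i ∈ Finset.range m, dirichletPoly i

theorem coeff_dirichletPoly (i j : ℕ) :
    (dirichletPoly i).coeff j = if j = 0 then 1 else if j ≤ i then 2 else 0 := by
  rw [dirichletPoly, coeff_add, coeff_one, finsetSum_coeff]
  simp_rw [coeff_C_mul, coeff_X_pow]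
  rcases j with _ | j
  · simp
  · simp

theorem coeff_fejerPoly_nonneg (m j : ℕ) : 0 ≤ (fejerPoly m).coeff j := by
  rw [fejerPoly, coeff_C_mul, finsetSum_coeff]
  refine mul_nonneg (by positivity) (Finset.sum_nonneg fun i _ => ?_)
  rw [coeff_dirichletPoly]
  split_ifs <;> norm_num

/-- For `j ≥ 1` the `n + 1` indices `i` from `n` to `2n` each contribute `2`, and `2(n + 1) ≥ 2n +
1`. -/
theorem one_le_coeff_fejerPoly {n j : ℕ} (hj : j ≤ n) : 1 ≤ (fejerPoly (2 * n + 1)).coeff j := by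
  rw [fejerPoly, coeff_C_mul, finsetSum_coeff, inv_mul_eq_div, one_le_div (by positivity)]
  simp_rw [coeff_dirichletPoly]
  by_cases h0 : j = 0
  · simp [h0]
  · simp only [h0, if_false]
    have h1 : Finset.Ico n (2 * n + 1) ⊆ Finset.range (2 * n + 1) := by
      intro i hi
      rw [Finset.mem_Ico] at hi
      exact Finset.mem_range.2 hi.2
    refine le_trans ?_ (Finset.sum_le_sum_of_subset_of_nonneg h1 fun i _ _ => by
      split_ifs <;> norm_num)
    rw [Finset.sum_congr rfl (g := fun _ => (2 : ℝ)) fun i hi => if_pos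
      (hj.trans (Finset.mem_Ico.1 hi).1), Finset.sum_const, Nat.card_Ico, nsmul_eq_mul]
    have : 2 * n + 1 - n = n + 1 := by omega
    rw [this]
    push_cast
    linarith

/-- Fejér's identity: enlarging `m` by one adds the real part of one Dirichlet polynomial to the
left and the same amount to the squared modulus on the right. -/
theorem re_sum_dirichletPoly_eq {w : ℂ} (hw : ‖w‖ = 1) (m : ℕ) :
    (∑ i ∈ Finset.range m, aeval w (dirichletPoly i)).re
      = ‖∑ j ∈ Finset.range m, w ^ j‖ ^ 2 := by
  induction m with
  | zero => simp
  | succ m ih =>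
    rw [Finset.sum_range_succ, Finset.sum_range_succ, Complex.add_re, ih]
    set q := ∑ j ∈ Finset.range m, w ^ j
    have h1 : ‖q + w ^ m‖ ^ 2 = ‖q‖ ^ 2 + 1 + 2 * (w ^ m * (starRingEnd ℂ) q).re := by
      rw [← Complex.normSq_eq_norm_sq, ← Complex.normSq_eq_norm_sq, add_comm q, Complex.normSq_add,
        Complex.normSq_eq_norm_sq (w ^ m), norm_pow, hw]
      ring
    have hwc : w * (starRingEnd ℂ) w = 1 := by
      rw [Complex.mul_conj, Complex.normSq_eq_norm_sq, hw]
      simp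
    have h2 : w ^ m * (starRingEnd ℂ) q = ∑ j ∈ Finset.range m, w ^ (j + 1) := by
      rw [map_sum, Finset.mul_sum, ← Finset.sum_range_reflect]
      refine Finset.sum_congr rfl fun j hj => ?_
      have hj' := Finset.mem_range.1 hj
      have h3 : m = (j + 1) + (m - 1 - j) := by omega
      conv_lhs => rw [h3, pow_add]
      rw [map_pow, show j + 1 + (m - 1 - j) - 1 - j = m - 1 - j by omega, mul_assoc, ← mul_pow, hwc]
      simp
    rw [h1, h2, dirichletPoly]
    simp only [map_add, map_one, map_sum, map_mul, map_pow, aeval_X, aeval_C, Complex.add_re,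
      Complex.one_re, ← Finset.mul_sum]
    simp
    ring

/-- Nonnegativity on the circle passes to the disc by the maximum principle for `e^{-F}`. -/
theorem re_aeval_fejerPoly_nonneg (m : ℕ) {w : ℂ} (hw : ‖w‖ ≤ 1) :
    0 ≤ (aeval w (fejerPoly m)).re := by
  have hd : Differentiable ℂ fun w : ℂ => Complex.exp (-aeval w (fejerPoly m)) :=
    ((fejerPoly m).differentiable_aeval).neg.cexp
  have h := Complex.norm_le_of_forall_mem_frontier_norm_le (U := Metric.ball (0 : ℂ) 1)
    Metric.isBounded_ball hd.diffContOnCl (C := 1) (z := w) (fun z hz => ?_) (by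
      rw [closure_ball _ one_ne_zero]; simpa using hw)
  · rw [Complex.norm_exp, Complex.neg_re, Real.exp_le_one_iff] at h
    linarith
  · rw [frontier_ball _ one_ne_zero, mem_sphere_zero_iff_norm] at hz
    rw [Complex.norm_exp, Complex.neg_re, Real.exp_le_one_iff, neg_nonpos]
    have h1 : aeval z (fejerPoly m)
        = ((m : ℝ)⁻¹ : ℝ) * ∑ i ∈ Finset.range m, aeval z (dirichletPoly i) := by
      simp [fejerPoly]
    rw [h1, Complex.re_ofReal_mul, re_sum_dirichletPoly_eq hz]
    positivity

theorem aeval_zero_fejerPoly {m : ℕ} (hm : m ≠ 0) : aeval (0 : ℂ) (fejerPoly m) = 1 := by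
  have : (m : ℂ) ≠ 0 := by exact_mod_cast hm
  simp [fejerPoly, dirichletPoly, this]

/-- `κ (1 + (κ / k) F)^k` with the analytic completion `F` of a Fejér kernel. -/
noncomputable def testPoly (κ : ℝ) (k n : ℕ) : ℝ[X] :=
  C κ * (1 + C (κ / k) * fejerPoly (2 * n + 1)) ^ k

theorem coeff_pow_le {p q : ℝ[X]} (hp : ∀ j, 0 ≤ p.coeff j) (hpq : ∀ j, p.coeff j ≤ q.coeff j)
    (k j : ℕ) : 0 ≤ (p ^ k).coeff j ∧ (p ^ k).coeff j ≤ (q ^ k).coeff j := by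
  induction k generalizing j with
  | zero => simp only [pow_zero, le_refl, and_true, coeff_one]; split_ifs <;> norm_num
  | succ k ih =>
    simp only [pow_succ, coeff_mul]
    exact ⟨Finset.sum_nonneg fun x _ => mul_nonneg (ih _).1 (hp _),
      Finset.sum_le_sum fun x _ => mul_le_mul (ih _).2 (hpq _) (hp _) ((ih _).1.trans (ih _).2)⟩

/-- Truncate `K` of the factors at degree `L`: their product has degree at most `K L ≤ n`. The last
factor supplies each missing degree `n - i` with coefficient at least `a`. So the `n`-th coefficient
collects every coefficient of the truncated product, whose sum is its value at `1`. -/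
theorem le_coeff_testPoly {κ : ℝ} (hκ : 0 < κ) {K L n : ℕ} (hKL : K * L ≤ n) :
    κ * ((κ / (K + 1)) ^ (K + 1) * ((L : ℝ) + 1) ^ K) ≤ (testPoly κ (K + 1) n).coeff n := by
  set a := κ / (K + 1) with ha
  have ha0 : 0 < a := by positivity
  let g : ℕ → ℝ[X] := fun N => ∑ j ∈ Finset.range (N + 1), C a * X ^ j
  have hg : ∀ N j, (g N).coeff j = if j ≤ N then a else 0 := by
    intro N j
    simp only [g, finsetSum_coeff, coeff_C_mul, coeff_X_pow]
    simp
  have hg0 : ∀ N j, 0 ≤ (g N).coeff j := fun N j => by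
    rw [hg]; split_ifs <;> [exact ha0.le; exact le_rfl]
  set q : ℝ[X] := 1 + C (κ / ((K + 1 : ℕ) : ℝ)) * fejerPoly (2 * n + 1)
  have hgq : ∀ j, (g n).coeff j ≤ q.coeff j := by
    intro j
    rw [hg, coeff_add, coeff_C_mul, coeff_one]
    push_cast
    rw [← ha]
    have h1 := coeff_fejerPoly_nonneg (2 * n + 1) j
    have h2 : (0 : ℝ) ≤ if j = 0 then 1 else 0 := by split_ifs <;> norm_num
    by_cases h : j ≤ n
    · rw [if_pos h]
      nlinarith [one_le_coeff_fejerPoly h]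
    · rw [if_neg h]
      exact add_nonneg h2 (mul_nonneg ha0.le h1)
  -- For `K = 0` the hypothesis puts no bound on `L`, so `L ≤ n` is unavailable.
  by_cases hK : K = 0
  · subst hK
    rw [testPoly, coeff_C_mul]
    refine mul_le_mul_of_nonneg_left ?_ hκ.le
    have h1 := hgq n
    rw [hg, if_pos le_rfl] at h1
    calc _ = a := by simp [a]
      _ ≤ q.coeff n := h1
      _ = _ := congrArg (fun p : ℝ[X] => p.coeff n) (pow_one q).symm
  have hLn : L ≤ n := (Nat.le_mul_of_pos_left L (Nat.pos_of_ne_zero hK)).trans hKL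
  have hLq : ∀ j, (g L).coeff j ≤ q.coeff j := fun j => (by
    rw [hg, hg]
    split_ifs <;> first | omega | simp [ha0.le] : (g L).coeff j ≤ (g n).coeff j).trans (hgq j)
  have hpow := coeff_pow_le (hg0 L) hLq K
  have hdeg : (g L ^ K).natDegree ≤ n := by
    refine natDegree_pow_le.trans ((Nat.mul_le_mul_left K ?_).trans hKL)
    refine natDegree_le_iff_coeff_eq_zero.2 fun j hj => ?_
    rw [hg, if_neg (by omega)]
  have heval : (g L ^ K).eval 1 = (a * ((L : ℝ) + 1)) ^ K := by
    rw [eval_pow]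
    simp only [g, eval_finsetSum, eval_mul, eval_C, eval_pow, eval_X, one_pow, mul_one]
    rw [Finset.sum_const, Finset.card_range, nsmul_eq_mul, mul_comm]
    push_cast
    rfl
  rw [testPoly, coeff_C_mul]
  refine mul_le_mul_of_nonneg_left ?_ hκ.le
  rw [pow_succ q, coeff_mul, Finset.Nat.sum_antidiagonal_eq_sum_range_succ_mk]
  calc a ^ (K + 1) * ((L : ℝ) + 1) ^ K = (∑ i ∈ Finset.range (n + 1), (g L ^ K).coeff i) * a := by
        have h1 := eval_eq_sum_range' (Nat.lt_succ_of_le hdeg) (1 : ℝ)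
        rw [heval] at h1
        simp only [one_pow, mul_one] at h1
        rw [← h1, mul_pow]
        ring
    _ = ∑ i ∈ Finset.range (n + 1), (g L ^ K).coeff i * (g n).coeff (n - i) := by
        rw [Finset.sum_mul]
        refine Finset.sum_congr rfl fun i _ => ?_
        rw [hg, if_pos (Nat.sub_le n i)]
    _ ≤ _ := Finset.sum_le_sum fun i _ =>
        mul_le_mul (hpow i).2 (hgq _) (hg0 _ _) ((hpow i).1.trans (hpow i).2)

/-- The base `g = 1 + (κ/k) F` satisfies `|g| ≥ 1`, so `log (1 + κ|g|^k) ≤ κ + k log |g|`. Since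
`log |g|` is harmonic, its mean is `log (1 + κ/k) ≤ κ/k`. -/
theorem circleAverage_testPoly_le {κ : ℝ} (hκ : 0 < κ) {k : ℕ} (hk : k ≠ 0) (n : ℕ) {s : ℂ}
    (hs : ‖s‖ ≤ 1) {r : ℝ} (hr : r ∈ Set.Ioo (0 : ℝ) 1) :
    Real.circleAverage (fun w => Real.log (1 + ‖aeval (w * s) (testPoly κ k n)‖)) 0 r
      ≤ 2 * κ := by
  have hk0 : (0 : ℝ) < k := by exact_mod_cast Nat.pos_of_ne_zero hk
  let g : ℂ → ℂ := fun w => 1 + ((κ / k : ℝ) : ℂ) * aeval (w * s) (fejerPoly (2 * n + 1))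
  have hgd : Differentiable ℂ g := by
    have := (fejerPoly (2 * n + 1)).differentiable_aeval (𝕜 := ℂ)
    have h2 : Differentiable ℂ fun w : ℂ => aeval (w * s) (fejerPoly (2 * n + 1)) :=
      this.comp (differentiable_id.mul_const s)
    fun_prop
  have hg1 : ∀ w ∈ Metric.closedBall (0 : ℂ) |r|, 1 ≤ ‖g w‖ := by
    intro w hw
    rw [mem_closedBall_zero_iff, abs_of_pos hr.1] at hw
    have h1 : 0 ≤ (aeval (w * s) (fejerPoly (2 * n + 1))).re := re_aeval_fejerPoly_nonneg _ (by
      rw [norm_mul]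
      exact mul_le_one₀ (hw.trans hr.2.le) (norm_nonneg _) hs)
    refine le_trans ?_ ((le_abs_self _).trans (Complex.abs_re_le_norm _))
    simp only [g, Complex.add_re, Complex.one_re, Complex.re_ofReal_mul]
    have : 0 ≤ κ / k * (aeval (w * s) (fejerPoly (2 * n + 1))).re := by positivity
    linarith
  have hg0 : ∀ w ∈ Metric.closedBall (0 : ℂ) |r|, g w ≠ 0 := fun w hw h => by
    have := hg1 w hw
    rw [h, norm_zero] at this
    linarith
  have hP : ∀ w, aeval (w * s) (testPoly κ k n) = κ * g w ^ k := by
    intro w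
    simp [testPoly, g]
  have hmean : Real.circleAverage (fun w => Real.log ‖g w‖) 0 r = Real.log ‖g 0‖ :=
    AnalyticOnNhd.circleAverage_log_norm_of_ne_zero
      (fun z _ => hgd.analyticAt z) hg0
  have hg00 : ‖g 0‖ = 1 + κ / k := by
    simp only [g, zero_mul, aeval_zero_fejerPoly (Nat.succ_ne_zero _), mul_one]
    rw [← Complex.ofReal_one, ← Complex.ofReal_add, Complex.norm_real, Real.norm_of_nonneg]
    positivity
  have hsub : Metric.sphere (0 : ℂ) r ⊆ Metric.closedBall 0 |r| := by
    rw [abs_of_pos hr.1]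
    exact Metric.sphere_subset_closedBall
  have hc1 : ContinuousOn (fun w => Real.log ‖g w‖) (Metric.sphere 0 r) :=
    ContinuousOn.log hgd.continuous.norm.continuousOn fun w hw => by
      have := hg1 w (hsub hw)
      linarith
  have hc2 : ContinuousOn (fun w => Real.log (1 + ‖aeval (w * s) (testPoly κ k n)‖))
      (Metric.sphere 0 r) := by
    simp_rw [hP]
    refine ContinuousOn.log ?_ fun w _ => by positivity
    exact (continuous_const.add
      (continuous_const.mul (hgd.continuous.pow k)).norm).continuousOn
  have hadd := Real.circleAverage_fun_add (f₂ := fun w => (k : ℝ) • Real.log ‖g w‖)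
    (circleIntegrable_const κ 0 r) ((hc1.const_smul (k : ℝ)).circleIntegrable hr.1.le)
  have hsm := Real.circleAverage_fun_smul (a := (k : ℝ)) (f := fun w => Real.log ‖g w‖) (c := 0)
    (R := r)
  rw [hsm, Real.circleAverage_const, hmean, hg00, smul_eq_mul] at hadd
  calc _ ≤ Real.circleAverage (fun w => κ + (k : ℝ) • Real.log ‖g w‖) 0 r := by
        refine Real.circleAverage_mono (hc2.circleIntegrable hr.1.le)
          ((continuousOn_const.add (hc1.const_smul (k : ℝ))).circleIntegrable hr.1.le) fun w hw => ?_
        have hw1 := hg1 w (Metric.sphere_subset_closedBall hw)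
        simp only [hP, norm_mul, norm_pow, Complex.norm_real, Real.norm_of_nonneg hκ.le]
        have h1 : 1 ≤ ‖g w‖ ^ k := one_le_pow₀ hw1
        calc Real.log (1 + κ * ‖g w‖ ^ k) ≤ Real.log ((1 + κ) * ‖g w‖ ^ k) := by
              refine Real.log_le_log (by positivity) ?_
              linarith
          _ = Real.log (1 + κ) + k * Real.log ‖g w‖ := by
              rw [Real.log_mul (by positivity) (by positivity), Real.log_pow]
          _ ≤ _ := by
              have := Real.log_le_sub_one_of_pos (x := 1 + κ) (by positivity)
              rw [smul_eq_mul]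
              linarith
    _ = κ + k * Real.log (1 + κ / k) := hadd
    _ ≤ κ + k * (κ / k) := by
        have := Real.log_le_sub_one_of_pos (x := 1 + κ / k) (by positivity)
        gcongr
        linarith
    _ = 2 * κ := by
        field_simp
        ring

/-- Polynomials with small logarithmic means and a large coefficient. -/
theorem exists_polynomial_large_coeff {κ : ℝ} (hκ : 0 < κ) (hκ1 : κ ≤ 1) (n : ℕ) :
    ∃ P : ℝ[X], κ ^ 2 * Real.exp (-(1 / 2)) / (n + 1) *
        Real.exp (Real.sqrt κ / 4 * Real.sqrt n) ≤ P.coeff n ∧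
      ∀ s : ℂ, ‖s‖ ≤ 1 → ∀ r ∈ Set.Ioo (0 : ℝ) 1,
        Real.circleAverage (fun w => Real.log (1 + ‖aeval (w * s) P‖)) 0 r ≤ 2 * κ := by
  set x := Real.sqrt κ * Real.sqrt n / 2 with hx
  have hx0 : 0 ≤ x := by positivity
  have hxx : x ^ 2 = κ * n / 4 := by
    rw [hx, div_pow, mul_pow, Real.sq_sqrt hκ.le, Real.sq_sqrt (Nat.cast_nonneg n)]
    norm_num
  -- From `K² ≤ κn/4` and `L` about `n/K`, the base `κ(L+1)/(K+1)` is at least `2` when `K ≥ 1`. For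
  -- `K = 0` the quotient `n / K` is `0` and the power is `1`.
  set K := ⌊x⌋₊
  have hK : (K : ℝ) ≤ x := Nat.floor_le hx0
  have hK' : x < K + 1 := Nat.lt_floor_add_one x
  refine ⟨testPoly κ (K + 1) n, ?_, fun s hs r hr =>
    circleAverage_testPoly_le hκ (Nat.succ_ne_zero K) n hs hr⟩
  refine le_trans ?_ (le_coeff_testPoly hκ (Nat.mul_div_le n K))
  set L := n / K
  have hexp : Real.exp (1 / 2) ≤ 2 := by
    have h1 : Real.exp (1 / 2) ^ 2 = Real.exp 1 := by
      rw [← Real.exp_nat_mul]; norm_num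
    nlinarith [Real.exp_one_lt_d9, Real.exp_pos (1 / 2)]
  have hpow : Real.exp (-(1 / 2)) * Real.exp (Real.sqrt κ / 4 * Real.sqrt n) ≤ 2 ^ K := by
    calc _ = Real.exp (x / 2 - 1 / 2) := by
          rw [← Real.exp_add, hx]
          ring_nf
      _ ≤ Real.exp (K * (1 / 2)) := Real.exp_le_exp.2 (by linarith)
      _ = Real.exp (1 / 2) ^ K := Real.exp_nat_mul _ _
      _ ≤ 2 ^ K := by gcongr
  have hbase : (2 : ℝ) ^ K ≤ (κ / (K + 1) * ((L : ℝ) + 1)) ^ K := by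
    rcases Nat.eq_zero_or_pos K with h0 | hKp
    · simp [h0]
    · refine pow_le_pow_left₀ (by norm_num) ?_ _
      have hK1 : (1 : ℝ) ≤ K := by exact_mod_cast hKp
      have hL : (n : ℝ) < ((L : ℝ) + 1) * K := by
        have := Nat.lt_div_mul_add (a := n) hKp
        have h2 : (n : ℝ) < (n / K : ℕ) * K + K := by exact_mod_cast this
        simp only [L]
        linarith
      rw [div_mul_eq_mul_div, le_div_iff₀ (by positivity)]
      have h3 : (K : ℝ) * (4 * K) ≤ K * (κ * (L + 1)) := by
        have : (K : ℝ) ^ 2 ≤ κ * n / 4 := hxx ▸ pow_le_pow_left₀ (by positivity) hK 2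
        nlinarith
      have h4 := le_of_mul_le_mul_left h3 (by linarith)
      linarith
  have hKn : (K : ℝ) ≤ n := by
    have h1 : (K : ℝ) ^ 2 ≤ κ * n / 4 := hxx ▸ pow_le_pow_left₀ (by positivity) hK 2
    have h2 : (K : ℝ) ^ 2 ≤ n := by nlinarith [Nat.cast_nonneg (α := ℝ) n]
    have h3 : K ^ 2 ≤ n := by exact_mod_cast h2
    exact_mod_cast (Nat.le_self_pow two_ne_zero K).trans h3
  calc _ = κ * (κ / (n + 1)) *
        (Real.exp (-(1 / 2)) * Real.exp (Real.sqrt κ / 4 * Real.sqrt n)) := by ring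
    _ ≤ κ * (κ / (K + 1)) * (κ / (K + 1) * ((L : ℝ) + 1)) ^ K := by
        gcongr
        exact hpow.trans hbase
    _ = _ := by
        rw [mul_pow, pow_succ]
        ring

end TestPolynomial

/-! ### Necessity: testing the functional on ridge functions -/

section Necessity

variable {d : ℕ}

theorem homogPart_monomialFun (α : Fin d → ℕ) (n : ℕ) (z : Cd d) :
    homogPart (monomialFun α) n z = if n = length α then ∏ i, z i ^ α i else 0 := by
  have hn : (n.factorial : ℂ) ≠ 0 := by exact_mod_cast Nat.factorial_ne_zero n
  refine mul_left_cancel₀ hn ?_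
  rw [← iteratedDeriv_slice ((isHolo_monomialFun α).1 0 (by simp))]
  have h1 : (fun w : ℂ => monomialFun α (w • z)) =ᶠ[𝓝 0]
      fun w => (∏ i, z i ^ α i) * w ^ length α := by
    have h2 : Filter.Tendsto (fun w : ℂ => w • z) (𝓝 0) (𝓝 0) := by
      have : Continuous fun w : ℂ => w • z := by fun_prop
      simpa using this.tendsto 0
    filter_upwards [h2.eventually (Metric.ball_mem_nhds 0 one_pos)] with w hw
    rw [monomialFun, if_pos (show w • z ∈ unitBall d from hw)]
    simp only [PiLp.smul_apply, smul_eq_mul, mul_pow, Finset.prod_mul_distrib,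
      Finset.prod_pow_eq_pow_sum, length]
    ring
  rw [h1.iteratedDeriv_eq, iteratedDeriv_const_mul_field, iteratedDeriv_fun_pow_zero]
  split_ifs with h
  · rw [h, mul_comm]
  · simp

/-- Comparison of coefficients, again by the Cauchy estimate with bound `0`. -/
theorem taylorCoeff_monomialFun [DecidableEq (Fin d → ℕ)] (α β : Fin d → ℕ) :
    taylorCoeff (monomialFun α) β = if β = α then 1 else 0 := by
  have h1 : ∀ z : Fin d → ℂ, (∀ i, ‖z i‖ = (1 : ℝ)) →
      ‖∑ β' ∈ Finset.univ.piAntidiag (length β),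
        (taylorCoeff (monomialFun α) β' - if β' = α then 1 else 0) * ∏ i, z i ^ β' i‖ ≤ 0 := by
    intro z _
    have h2 := homogPart_monomialFun α (length β) (WithLp.toLp 2 z)
    rw [homogPart] at h2
    simp only at h2
    simp_rw [sub_mul]
    rw [Finset.sum_sub_distrib, h2]
    simp only [ite_mul, one_mul, zero_mul, Finset.sum_ite_eq', Finset.mem_piAntidiag]
    simp [length, eq_comm]
  have h2 := norm_coeff_mul_le (r := fun _ => 1) _ _ (fun _ => zero_le_one) h1
    (α := β) (by simp [Finset.mem_piAntidiag, length])
  simpa [sub_eq_zero] using h2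

/-- Evaluation at a point as a linear functional on `N_u^+`. -/
def NuPlus.evalAt (z : Cd d) : NuPlus d →ₗ[ℂ] ℂ where
  toFun f := f z
  map_add' _ _ := rfl
  map_smul' _ _ := rfl

/-- The function `z ↦ P (∑ z_i η_i)` as an element of `N_u^+`. -/
noncomputable def ridge (P : Polynomial ℝ) (η : Fin d → ℂ) : NuPlus d :=
  ∑ m ∈ Finset.range (P.natDegree + 1), ∑ α ∈ Finset.univ.piAntidiag m,
    ((P.coeff m : ℂ) * Nat.multinomial Finset.univ α * ∏ i, η i ^ α i) • NuPlus.monomial α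

theorem ridge_apply (P : Polynomial ℝ) (η : Fin d → ℂ) {z : Cd d} (hz : z ∈ unitBall d) :
    ridge P η z = Polynomial.aeval (∑ i, z i * η i) P := by
  change NuPlus.evalAt z (ridge P η) = _
  rw [ridge, map_sum, Polynomial.aeval_eq_sum_range]
  refine Finset.sum_congr rfl fun m _ => ?_
  rw [map_sum, Finset.sum_pow_eq_sum_piAntidiag, Finset.smul_sum]
  refine Finset.sum_congr rfl fun α _ => ?_
  have h1 : NuPlus.evalAt z (NuPlus.monomial α) = ∏ i, z i ^ α i := if_pos hz
  rw [map_smul, h1, smul_eq_mul, Complex.real_smul]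
  simp_rw [mul_pow, Finset.prod_mul_distrib]
  ring

/-- On the slice through `ζ` the function is `w ↦ P(w s)` with `s = ∑ ζ_i η_i`, and `|s| ≤ 1` by
Cauchy–Schwarz. -/
theorem logGauge_ridge_le {P : Polynomial ℝ} {C : ℝ}
    (hP : ∀ s : ℂ, ‖s‖ ≤ 1 → ∀ r ∈ Set.Ioo (0 : ℝ) 1,
      Real.circleAverage (fun w => Real.log (1 + ‖Polynomial.aeval (w * s) P‖)) 0 r ≤ C)
    {η : Fin d → ℂ} (hη : ∑ i, ‖η i‖ ^ 2 = 1) : logGauge (ridge P η) ≤ ENNReal.ofReal C := by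
  refine iSup₂_le fun ζ hζ => iSup₂_le fun r hr => ENNReal.ofReal_le_ofReal ?_
  have hs : ‖∑ i, ζ i * η i‖ ≤ 1 := by
    have h1 : ∑ i, ‖ζ i‖ ^ 2 = 1 := by
      rw [← EuclideanSpace.norm_sq_eq, mem_sphere_zero_iff_norm.1 hζ, one_pow]
    have h2 := Finset.sum_mul_sq_le_sq_mul_sq Finset.univ (fun i => ‖ζ i‖) fun i => ‖η i‖
    rw [h1, hη] at h2
    have h3 : ‖∑ i, ζ i * η i‖ ≤ ∑ i, ‖ζ i‖ * ‖η i‖ :=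
      (norm_sum_le _ _).trans (le_of_eq (by simp_rw [norm_mul]))
    have h4 : ∑ i, ‖ζ i‖ * ‖η i‖ ≤ 1 := by
      rw [← sq_le_one_iff₀ (Finset.sum_nonneg fun i _ => by positivity)]
      linarith
    exact h3.trans h4
  refine le_trans (le_of_eq (Real.circleAverage_congr_sphere fun w hw => ?_)) (hP _ hs r hr)
  rw [abs_of_pos hr.1] at hw
  simp only [ridge_apply P η (circle_mem hζ hr hw)]
  rw [Finset.mul_sum]
  simp [mul_assoc]

/-- The value of `Γ` on the ridge function is a polynomial in `η` with coefficients `P_m` times a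
multinomial times `conj γ_β`; the Cauchy estimate in `η` extracts one of them. -/
theorem norm_coeff_mul_le_of_functional {γ : (Fin d → ℕ) → ℂ} (Γ : NuPlus d →ₗ[ℂ] ℂ)
    (hΓ : ∀ α, Γ (NuPlus.monomial α) = (starRingEnd ℂ) (γ α)) {P : Polynomial ℝ} {C : ℝ}
    {r : Fin d → ℝ} (hr : ∀ i, 0 ≤ r i)
    (hC : ∀ η : Fin d → ℂ, (∀ i, ‖η i‖ = r i) → ‖Γ (ridge P η)‖ ≤ C) {α : Fin d → ℕ}
    (hα : 0 < P.coeff (length α)) :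
    P.coeff (length α) * Nat.multinomial Finset.univ α * ‖γ α‖ * ∏ i, r i ^ α i ≤ C := by
  classical
  set S := (Finset.range (P.natDegree + 1)).biUnion fun m =>
    (Finset.univ : Finset (Fin d)).piAntidiag m
  have hS : Set.PairwiseDisjoint (↑(Finset.range (P.natDegree + 1)))
      fun m : ℕ => (Finset.univ : Finset (Fin d)).piAntidiag m := by
    intro m _ m' _ hmm'
    rw [Function.onFun, Finset.disjoint_left]
    intro β hβ hβ'
    exact hmm' ((Finset.mem_piAntidiag.1 hβ).1.symm.trans (Finset.mem_piAntidiag.1 hβ').1)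
  have h := norm_coeff_mul_le S
    (fun β => (P.coeff (length β) : ℂ) * Nat.multinomial Finset.univ β * (starRingEnd ℂ) (γ β)) hr
    (C := C) (fun η hη => ?_) (α := α) ?_
  · simpa [abs_of_pos hα] using h
  · refine le_trans (le_of_eq ?_) (hC η hη)
    congr 1
    rw [ridge, map_sum, Finset.sum_biUnion hS]
    refine Finset.sum_congr rfl fun m _ => ?_
    rw [map_sum]
    refine Finset.sum_congr rfl fun β hβ => ?_
    have hm : length β = m := (Finset.mem_piAntidiag.1 hβ).1
    rw [map_smul, hΓ, hm, smul_eq_mul]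
    ring
  · refine Finset.mem_biUnion.2 ⟨length α, Finset.mem_range.2 (Nat.lt_succ_of_le
      (Polynomial.le_natDegree_of_ne_zero hα.ne')), ?_⟩
    simp [Finset.mem_piAntidiag, length]

theorem decayCondition_of_continuous [NeZero d] {γ : (Fin d → ℕ) → ℂ} (Γ : NuPlus d →L[ℂ] ℂ)
    (hΓ : ∀ α, Γ (NuPlus.monomial α) = (starRingEnd ℂ) (γ α)) : DecayCondition γ := by
  obtain ⟨ε, hε, hΓε⟩ := Metric.continuousAt_iff.1 (Γ.continuous.continuousAt (x := 0)) 1 one_pos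
  -- The gauge of the test functions is at most `2κ`, which must stay below `ε`.
  set κ := min 1 (ε / 4)
  have hκ : 0 < κ := by positivity
  have hκε : 2 * κ < ε := by linarith [min_le_right 1 (ε / 4)]
  obtain ⟨B, hB, hpoly⟩ := exists_pow_mul_exp_neg_sqrt_le (d + 1)
    (c := Real.sqrt κ / 8) (by positivity)
  set A := κ ^ 2 * Real.exp (-(1 / 2))
  have hA : 0 < A := by positivity
  refine ⟨Real.exp 1 ^ d / A * B, by positivity, Real.sqrt κ / 8, by positivity, fun α => ?_⟩
  set n := length α with hn
  obtain ⟨P, hP, hPavg⟩ := exists_polynomial_large_coeff hκ (min_le_left _ _) n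
  obtain ⟨r, hr, hr1, hω⟩ := exists_omega_le α
  have hPn : 0 < P.coeff n := lt_of_lt_of_le (by positivity) hP
  have h1 := norm_coeff_mul_le_of_functional (Γ : NuPlus d →ₗ[ℂ] ℂ) hΓ (P := P) (C := 1) hr
    (fun η hη => ?_) (α := α) hPn
  · set R := ∏ i, r i ^ α i
    set m : ℝ := (Nat.multinomial Finset.univ α : ℝ)
    have hm : omega α ^ 2 * m = 1 := omega_sq_mul_multinomial α
    have hω0 := omega_pos α
    set s := Real.sqrt n
    have hE : Real.exp (-(Real.sqrt κ / 4) * s) * Real.exp (Real.sqrt κ / 4 * s) = 1 := by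
      rw [← Real.exp_add]
      simp
    -- The identity `ω_α² · multinomial = 1` trades the multinomial for `ω_α⁻²`: one power is spent
    -- on `r^α`, the other remains as the weight.
    have h2 : P.coeff n * ‖γ α‖ ≤ (Real.exp 1 * (n + 1)) ^ d * omega α := by
      have h3 : P.coeff n * ‖γ α‖ = (P.coeff n * m * ‖γ α‖ * omega α) * omega α := by
        calc _ = P.coeff n * ‖γ α‖ * (omega α ^ 2 * m) := by rw [hm, mul_one]
          _ = _ := by ring
      rw [h3]
      refine mul_le_mul_of_nonneg_right ?_ hω0.le
      calc _ ≤ P.coeff n * m * ‖γ α‖ * ((Real.exp 1 * (n + 1)) ^ d * R) := by gcongr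
        _ = (Real.exp 1 * (n + 1)) ^ d * (P.coeff n * m * ‖γ α‖ * R) := by ring
        _ ≤ (Real.exp 1 * (n + 1)) ^ d * 1 := by gcongr
        _ = _ := mul_one _
    have h4 : A / (n + 1) * Real.exp (Real.sqrt κ / 4 * s) * ‖γ α‖
        ≤ (Real.exp 1 * (n + 1)) ^ d * omega α :=
      (mul_le_mul_of_nonneg_right hP (norm_nonneg _)).trans h2
    calc ‖γ α‖ = (n + 1) / A * Real.exp (-(Real.sqrt κ / 4) * s) *
          (A / (n + 1) * Real.exp (Real.sqrt κ / 4 * s) * ‖γ α‖) := by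
          have : ((n : ℝ) + 1) / A * (A / (n + 1)) = 1 := by field_simp
          linear_combination (-‖γ α‖) * this - ((n : ℝ) + 1) / A * (A / (n + 1)) * ‖γ α‖ * hE
      _ ≤ (n + 1) / A * Real.exp (-(Real.sqrt κ / 4) * s) *
          ((Real.exp 1 * (n + 1)) ^ d * omega α) := by gcongr
      -- The rate `√κ/4` is split in half: one half absorbs `(n + 1)^(d + 1)`, the other is the
      -- final decay.
      _ = Real.exp 1 ^ d / A * (((n : ℝ) + 1) ^ (d + 1) * Real.exp (-(Real.sqrt κ / 8) * s)) *
          omega α * Real.exp (-(Real.sqrt κ / 8) * s) := by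
          have : Real.exp (-(Real.sqrt κ / 4) * s)
              = Real.exp (-(Real.sqrt κ / 8) * s) * Real.exp (-(Real.sqrt κ / 8) * s) := by
            rw [← Real.exp_add]
            ring_nf
          rw [this, mul_pow, pow_succ]
          ring
      _ ≤ _ := by
          gcongr
          exact hpoly n
  · have hη1 : ∑ i, ‖η i‖ ^ 2 = 1 := by simp_rw [hη, hr1]
    have hg := logGauge_ridge_le hPavg hη1
    have hdist : dist (ridge P η) 0 < ε := by
      have h3 : logGauge (fun z => ridge P η z - (0 : NuPlus d) z) = logGauge (ridge P η) := by
        congr 1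
        funext z
        exact sub_zero _
      rw [NuPlus.dist_def, h3]
      refine lt_of_le_of_lt ?_ hκε
      exact ENNReal.toReal_le_of_le_ofReal (by positivity) hg
    have := hΓε hdist
    rw [map_zero, dist_zero_right] at this
    exact this.le

end Necessity
end UniformSmirnov

theorem theorem1p10 (d : ℕ) [NeZero d] (γ : (Fin d → ℕ) → ℂ) :
    -- the series defines a continuous linear functional on `(N_u^+, ρ)`
    ((∃ Γ : UniformSmirnov.NuPlus d →L[ℂ] ℂ, ∀ f : UniformSmirnov.NuPlus d,
        HasSum (fun α : Fin d → ℕ =>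
          UniformSmirnov.taylorCoeff f α * (starRingEnd ℂ) (γ α)) (Γ f)) ↔
      UniformSmirnov.DecayCondition γ) ∧
    -- the functional given on polynomials by the finite sums extends continuously to `(N_u^+, ρ)`
    ((∃ Γ : UniformSmirnov.NuPlus d →L[ℂ] ℂ, ∀ α : Fin d → ℕ,
        Γ (UniformSmirnov.NuPlus.monomial α) = (starRingEnd ℂ) (γ α)) ↔
      UniformSmirnov.DecayCondition γ) ∧
    -- in this case the series converges absolutely for every `f` in `N_u^+`
    (UniformSmirnov.DecayCondition γ → ∀ f : UniformSmirnov.NuPlus d,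
      Summable fun α : Fin d → ℕ =>
        ‖UniformSmirnov.taylorCoeff f α * (starRingEnd ℂ) (γ α)‖) := by
  classical
  have hmono : ∀ Γ : UniformSmirnov.NuPlus d →L[ℂ] ℂ, (∀ f : UniformSmirnov.NuPlus d,
      HasSum (fun α : Fin d → ℕ =>
        UniformSmirnov.taylorCoeff f α * (starRingEnd ℂ) (γ α)) (Γ f)) →
      ∀ α, Γ (UniformSmirnov.NuPlus.monomial α) = (starRingEnd ℂ) (γ α) := by
    intro Γ hΓ α
    refine (hΓ (UniformSmirnov.NuPlus.monomial α)).unique ?_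
    have h1 : ∀ β, UniformSmirnov.taylorCoeff (UniformSmirnov.NuPlus.monomial α) β
        = if β = α then 1 else 0 := UniformSmirnov.taylorCoeff_monomialFun α
    have h2 := hasSum_ite_eq α ((starRingEnd ℂ) (γ α))
    refine h2.congr_fun ?_
    intro β
    rw [h1]
    split_ifs with h
    · rw [h, one_mul]
    · rw [zero_mul]
  have hsuff : UniformSmirnov.DecayCondition γ → ∃ Γ : UniformSmirnov.NuPlus d →L[ℂ] ℂ,
      ∀ f : UniformSmirnov.NuPlus d, HasSum (fun α : Fin d → ℕ =>
        UniformSmirnov.taylorCoeff f α * (starRingEnd ℂ) (γ α)) (Γ f) :=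
    fun hγ => ⟨⟨hγ.functional, hγ.continuous_functional⟩, hγ.hasSum⟩
  refine ⟨⟨fun ⟨Γ, hΓ⟩ => UniformSmirnov.decayCondition_of_continuous Γ (hmono Γ hΓ), hsuff⟩,
    ⟨fun ⟨Γ, hΓ⟩ => UniformSmirnov.decayCondition_of_continuous Γ hΓ, fun hγ => ?_⟩,
    fun hγ f => hγ.summable_norm f⟩
  obtain ⟨Γ, hΓ⟩ := hsuff hγ
  exact ⟨Γ, hmono Γ hΓ⟩
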